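/- Let $\Gamma$ be a compact metric graph with finitely many (at least one) edges $e=1,\dots,E$ of lengths $l_e>0$. Let $P$ be an orthogonal projector on $\mathbb{C}^{2E}$ and $L$ a self-adjoint map on $\mathbb{C}^{2E}$ with $P^\perp LP^\perp=L$, where $P^\perp=1-P$. For $\eta>0$ let $\Gamma_\eta$ be the graph with all edge lengths stretched to $\eta l_e$, let $\mathcal{L}=\eta\sum_e l_e$ be its total length, and let $-\Delta$ act as $(-\Delta\psi)_e=-\psi_e''$ in $L^2(\Gamma_\eta)=\bigoplus_e L^2(0,\eta l_e)$ on the domain $$\mathcal{D}(P,L)=\{\psi\in H^2(\Gamma_\eta):\ (P+L)\psi_{bv}+P^\perp\psi'_{bv}=0\},$$ where $$\psi_{bv}=(\psi_1(0),\dots,\psi_E(0),\psi_1(\eta l_1),\dots,\psi_E(\eta l_E)),\qquad \psi'_{bv}=(\psi_1'(0),\dots,\psi_E'(0),-\psi_1'(\eta l_1),\dots,-\psi_E'(\eta l_E)).$$ Let $k_0^2(\mathcal{L})\le k_1^2(\mathcal{L})\le\cdots$ be its eigenvalues, counted with multiplicity. Let $k_B>0$ be Boltzmann's constant. For a particle density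 $\rho>0$ and a temperature $T>0$, with $\beta=1/(k_BT)$, the chemical potential $\mu_{\mathcal{L}}$ of free bosons on $\Gamma_\eta$ is the number $\mu_{\mathcal{L}}<k_0^2(\mathcal{L})$ such that $$\sum_{n=0}^\infty\rho_n(\beta,\mu_{\mathcal{L}})=\rho,\qquad \rho_n(\beta,\mu_{\mathcal{L}})=\frac{1}{\mathcal{L}}\,\frac{1}{\mathrm{e}^{\beta(k_n^2(\mathcal{L})-\mu_{\mathcal{L}})}-1}.$$ One says that there is Bose--Einstein condensation (BEC) into the $n$-th eigenstate if $\limsup_{\mathcal{L}\to\infty}\rho_n(\beta,\mu_{\mathcal{L}})>0$, where the thermodynamic limit $\mathcal{L}\to\infty$ is taken by letting $\eta\to\infty$ with $P$, $L$, $\rho$ and $\beta$ fixed. Then: 1. For all $\rho,T,\eta>0$ the chemical potential exists and is unique. 2. If $L$ is negative semi-definite, then for every $\rho>0$ and every temperature $T>0$ there is no BEC into any eigenstate. 3. If $L$ has at least one positive eigenvalue, then for every $\rho>0$ there is a critical temperature $T_c>0$ such that, for every $T$ with $0<T<T_c$, there is BEC into the ground state ($n=0$). -/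

import Mathlib

open MeasureTheory Filter
open scoped ComplexOrder

noncomputable section

namespace QuantumGraph

/-- A compact metric graph with vertex set `V` and edge set `E` (both taken finite): every edge `e`
joins `src e` to `tgt e` and is identified with the interval `[0, len e]`, where the endpoint `0`
corresponds to `src e` and the endpoint `len e` to `tgt e`. -/
structure CompactMetricGraph (V E : Type*) where
  src : E → V
  tgt : E → V
  len : E → ℝ
  len_pos : ∀ e, 0 < len e

/-- The edge lengths `η * l_e` of the graph stretched uniformly by the factor `η`. -/
def CompactMetricGraph.scaledLen {V E : Type*} (Γ : CompactMetricGraph V E) (η : ℝ) : E → ℝ :=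
  fun e => η * Γ.len e

/-- The Hilbert space `L²(Γ) = ⨁ₑ L²(0, l_e)` for edge lengths `l`. -/
abbrev L2 {E : Type*} (l : E → ℝ) : Type _ :=
  PiLp 2 (fun e : E => Lp ℂ 2 (volume.restrict (Set.Ioo (0 : ℝ) (l e))))

/-- `u` is (the `C¹` representative of) an element of the Sobolev space `H²(0, a)`, with first
derivative `du`, which is absolutely continuous on `[0, a]`, and with second (weak) derivative
`d2u` in `L²(0, a)`. -/
structure IsH2 (a : ℝ) (u du d2u : ℝ → ℂ) : Prop where
  hasDerivWithinAt : ∀ x ∈ Set.Icc 0 a, HasDerivWithinAt u (du x) (Set.Icc 0 a) x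
  memLp : MemLp d2u 2 (volume.restrict (Set.Ioo 0 a))
  integral_eq : ∀ x ∈ Set.Icc 0 a, du x = du 0 + ∫ t in (0 : ℝ)..x, d2u t

/-- The boundary values `(ψ_1(0), …, ψ_E(0), ψ_1(l_1), …, ψ_E(l_E))`, an element of `ℂ^{2E}`. -/
def boundaryValues {E : Type*} (l : E → ℝ) (u : E → ℝ → ℂ) : E ⊕ E → ℂ :=
  Sum.elim (fun e => u e 0) (fun e => u e (l e))

/-- The inward derivatives `(ψ_1'(0), …, ψ_E'(0), -ψ_1'(l_1), …, -ψ_E'(l_E))`. -/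
def inwardDerivatives {E : Type*} (l : E → ℝ) (du : E → ℝ → ℂ) : E ⊕ E → ℂ :=
  Sum.elim (fun e => du e 0) (fun e => -du e (l e))

/-- `P` is an orthogonal projector on `ℂ^{2E}` and `L` is a self-adjoint map on `ℂ^{2E}` with
`P^⊥ L P^⊥ = L`, where `P^⊥ = 1 - P`. -/
structure IsBoundaryData {E : Type*} [Fintype E] [DecidableEq E]
    (P L : Matrix (E ⊕ E) (E ⊕ E) ℂ) : Prop where
  proj_isHermitian : P.IsHermitian
  proj_mul_self : P * P = P
  isHermitian : L.IsHermitian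
  compress : (1 - P) * L * (1 - P) = L

theorem IsH2.intervalIntegrable {a : ℝ} {u du d2u : ℝ → ℂ} (h : IsH2 a u du d2u)
    {x : ℝ} (hx : x ∈ Set.Icc 0 a) : IntervalIntegrable d2u volume 0 x := by
  rw [intervalIntegrable_iff_integrableOn_Ioo_of_le hx.1]
  have h1 : IntegrableOn d2u (Set.Ioo 0 a) volume := h.memLp.integrable (by norm_num)
  exact h1.mono_set (Set.Ioo_subset_Ioo_right hx.2)

theorem IsH2.zero (a : ℝ) : IsH2 a 0 0 0 where
  hasDerivWithinAt x _ := hasDerivWithinAt_const x _ (0 : ℂ)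
  memLp := MemLp.zero
  integral_eq x _ := by simp

theorem IsH2.add {a : ℝ} {u du d2u v dv d2v : ℝ → ℂ} (hu : IsH2 a u du d2u)
    (hv : IsH2 a v dv d2v) : IsH2 a (u + v) (du + dv) (d2u + d2v) where
  hasDerivWithinAt x hx := (hu.hasDerivWithinAt x hx).add (hv.hasDerivWithinAt x hx)
  memLp := hu.memLp.add hv.memLp
  integral_eq x hx := by
    have h := intervalIntegral.integral_add (hu.intervalIntegrable hx) (hv.intervalIntegrable hx)
    simp only [Pi.add_apply]
    rw [h, hu.integral_eq x hx, hv.integral_eq x hx]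
    ring

theorem IsH2.smul {a : ℝ} {u du d2u : ℝ → ℂ} (c : ℂ) (hu : IsH2 a u du d2u) :
    IsH2 a (c • u) (c • du) (c • d2u) where
  hasDerivWithinAt x hx := (hu.hasDerivWithinAt x hx).const_smul c
  memLp := hu.memLp.const_smul c
  integral_eq x hx := by
    have h := intervalIntegral.integral_smul (μ := volume) (a := 0) (b := x) c d2u
    simp only [Pi.smul_apply]
    rw [h, hu.integral_eq x hx, smul_add]

/-- The graph of the operator `-Δ` in `L²(Γ)` with the domain
`D(P, L) = {ψ ∈ H²(Γ) : (P + L) ψ_bv + P^⊥ ψ'_bv = 0}`: the set of pairs `(ψ, φ)` such that `ψ`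
belongs to `D(P, L)` and `φ_e = -ψ_e''` on every edge `e`. -/
def laplacianGraph {E : Type*} [Fintype E] [DecidableEq E] (l : E → ℝ)
    (P L : Matrix (E ⊕ E) (E ⊕ E) ℂ) : Submodule ℂ (L2 l × L2 l) where
  carrier := {p | ∃ u du d2u : E → ℝ → ℂ,
    (∀ e, IsH2 (l e) (u e) (du e) (d2u e)) ∧
    (∀ e, p.1 e =ᵐ[volume.restrict (Set.Ioo 0 (l e))] u e) ∧
    (∀ e, p.2 e =ᵐ[volume.restrict (Set.Ioo 0 (l e))] -d2u e) ∧
    (P + L).mulVec (boundaryValues l u) + (1 - P).mulVec (inwardDerivatives l du) = 0}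
  zero_mem' := by
    refine ⟨0, 0, 0, fun e => IsH2.zero _, fun e => ?_, fun e => ?_, ?_⟩
    · exact Lp.coeFn_zero _ _ _
    · simpa using Lp.coeFn_zero ℂ 2 (volume.restrict (Set.Ioo (0 : ℝ) (l e)))
    · have h1 : boundaryValues l (0 : E → ℝ → ℂ) = 0 := by
        ext i; cases i <;> simp [boundaryValues]
      have h2 : inwardDerivatives l (0 : E → ℝ → ℂ) = 0 := by
        ext i; cases i <;> simp [inwardDerivatives]
      rw [h1, h2, Matrix.mulVec_zero, Matrix.mulVec_zero, add_zero]
  add_mem' := by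
    rintro p q ⟨u, du, d2u, hu, hp1, hp2, hb⟩ ⟨v, dv, d2v, hv, hq1, hq2, hc⟩
    refine ⟨u + v, du + dv, d2u + d2v, fun e => (hu e).add (hv e), fun e => ?_, fun e => ?_, ?_⟩
    · filter_upwards [hp1 e, hq1 e, Lp.coeFn_add (p.1 e) (q.1 e)] with x h1 h2 h3
      simp only [Prod.fst_add, PiLp.add_apply, Pi.add_apply] at *
      rw [h3, h1, h2]
    · filter_upwards [hp2 e, hq2 e, Lp.coeFn_add (p.2 e) (q.2 e)] with x h1 h2 h3
      simp only [Prod.snd_add, PiLp.add_apply, Pi.add_apply, Pi.neg_apply] at *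
      rw [h3, h1, h2]
      ring
    · have h1 : boundaryValues l (u + v) = boundaryValues l u + boundaryValues l v := by
        ext i; cases i <;> simp [boundaryValues]
      have h2 : inwardDerivatives l (du + dv) =
          inwardDerivatives l du + inwardDerivatives l dv := by
        ext i; cases i <;> simp [inwardDerivatives, add_comm]
      rw [h1, h2, Matrix.mulVec_add, Matrix.mulVec_add, add_add_add_comm, hb, hc, add_zero]
  smul_mem' := by
    rintro c p ⟨u, du, d2u, hu, hp1, hp2, hb⟩
    refine ⟨c • u, c • du, c • d2u, fun e => (hu e).smul c, fun e => ?_, fun e => ?_, ?_⟩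
    · filter_upwards [hp1 e, Lp.coeFn_smul c (p.1 e)] with x h1 h3
      simp only [Prod.smul_fst, PiLp.smul_apply, Pi.smul_apply] at *
      rw [h3, h1]
    · filter_upwards [hp2 e, Lp.coeFn_smul c (p.2 e)] with x h1 h3
      simp only [Prod.smul_snd, PiLp.smul_apply, Pi.smul_apply, Pi.neg_apply] at *
      rw [h3, h1, smul_neg]
    · have h1 : boundaryValues l (c • u) = c • boundaryValues l u := by
        ext i; cases i <;> simp [boundaryValues]
      have h2 : inwardDerivatives l (c • du) = c • inwardDerivatives l du := by
        ext i; cases i <;> simp [inwardDerivatives]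
      rw [h1, h2, Matrix.mulVec_smul, Matrix.mulVec_smul, ← smul_add, hb, smul_zero]

/-- The eigenspace `{ψ ∈ D(P, L) : -Δψ = κ ψ}`. -/
def eigenspace {E : Type*} [Fintype E] [DecidableEq E] (l : E → ℝ)
    (P L : Matrix (E ⊕ E) (E ⊕ E) ℂ) (κ : ℝ) : Submodule ℂ (L2 l) :=
  (laplacianGraph l P L).comap (LinearMap.prod LinearMap.id ((κ : ℂ) • LinearMap.id))

/-- The eigenvalues `k_0² ≤ k_1² ≤ …` of `-Δ` on `D(P, L)`, in increasing order and repeated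
according to multiplicity: `k_n²` is the smallest `x` such that there are `n + 1` linearly
independent eigenfunctions with eigenvalues at most `x`. -/
def eigenvalue {E : Type*} [Fintype E] [DecidableEq E] (l : E → ℝ)
    (P L : Matrix (E ⊕ E) (E ⊕ E) ℂ) (n : ℕ) : ℝ :=
  sInf {x : ℝ | ∃ f : Fin (n + 1) → L2 l, LinearIndependent ℂ f ∧
    ∀ i, ∃ κ ≤ x, f i ∈ eigenspace l P L κ}

/-- The density `ρ_n(β, m) = (1 / 𝓛) * 1 / (exp (β (k_n² - m)) - 1)` of particles in the `n`-th
eigenstate, at inverse temperature `β` and chemical potential `m`; `𝓛 = ∑ₑ l_e` is the total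
length. -/
def occupationDensity {E : Type*} [Fintype E] [DecidableEq E] (l : E → ℝ)
    (P L : Matrix (E ⊕ E) (E ⊕ E) ℂ) (β m : ℝ) (n : ℕ) : ℝ :=
  (1 / ∑ e, l e) * (1 / (Real.exp (β * (eigenvalue l P L n - m)) - 1))

/-- `m` is the chemical potential of the free Bose gas with particle density `ρ` at inverse
temperature `β`: it lies below the ground state eigenvalue, and the densities of all eigenstates
add up to `ρ`. -/
def IsChemicalPotential {E : Type*} [Fintype E] [DecidableEq E] (l : E → ℝ)
    (P L : Matrix (E ⊕ E) (E ⊕ E) ℂ) (ρ β m : ℝ) : Prop :=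
  m < eigenvalue l P L 0 ∧ HasSum (occupationDensity l P L β m) ρ

/-- The `n`-th eigenstate is macroscopically occupied in the thermodynamic limit `η → ∞`, at
inverse temperature `β` and with chemical potentials `μ η`, i.e. there is Bose–Einstein
condensation into this eigenstate. (The upper limit is taken in the extended reals.) -/
def MacroscopicallyOccupied {V E : Type*} [Fintype E] [DecidableEq E]
    (Γ : CompactMetricGraph V E) (P L : Matrix (E ⊕ E) (E ⊕ E) ℂ) (β : ℝ) (μ : ℝ → ℝ)
    (n : ℕ) : Prop :=
  (0 : EReal) <
    limsup (fun η : ℝ => ((occupationDensity (Γ.scaledLen η) P L β (μ η) n : ℝ) : EReal)) atTop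

end QuantumGraph

end

/-!
The proof rests on three facts about the eigenvalues `k_n²` of `-Δ` on the stretched graph.

*Lower bounds.* On functions that vanish at all points of a grid containing the vertices, the
quadratic form of `-Δ` is that of decoupled short intervals with Dirichlet conditions, whatever `P`
and `L` are, and Poincaré's inequality makes it large (`IsRep.norm_sq_le_of_node`). The span of
sufficiently many eigenfunctions contains such a function, so `k_n²` grows at least like
`((n - 2 |E|) / (|E| R))²`, where `R` bounds the edge lengths (`sq_le_eigenvalue`). In particular
there are only finitely many non-positive eigenvalues.

*Upper bounds.* If `-s` lies below all eigenvalues, then `-Δ + s` is a bijection from the domain of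
`-Δ` onto `L²`: the differential equation has a particular solution on every edge, and the boundary
conditions become a square linear system for the coefficients of the homogeneous solutions, which
is injective. The inverse is symmetric, hence bounded by the Hellinger–Toeplitz theorem, and the
grid argument shows that it is small on subspaces of finite codimension, hence compact
(`resolvent_isCompactOperator`). The spectral theorem then gives the min-max principle in the form
`exists_linearIndependent_eigenfunctions`. Bumps on one edge show `k_n² ≤ C_n / η²`
(`exists_isTrialFamily`). An eigenvector `v` of `L` with eigenvalue `c > 0` gives a trial function
with boundary values `v` and inward derivatives `-c v` that decays inside the edges, so that
`k_0² ≤ -c² / 2` once the edges are long (`exists_isTrialFamily_of_hasEigenvalue`).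

*Sign.* If `L` is negative semi-definite, the quadratic form and all eigenvalues are non-negative.

The chemical potential exists and is unique because the total density is a convergent sum,
continuous and strictly increasing in `m`, that takes arbitrarily small and arbitrarily large values
on `(-∞, k_0²)` (`existsUnique_chemicalPotential`). If all eigenvalues are non-negative, a
density `ε` in one eigenstate would force a density of at least `ε / 4` in arbitrarily many
eigenstates, since `k_j² = O(η⁻²)` is negligible against the gap `O(η⁻¹)` between `μ` and the
energy of the occupied state (`eventually_occupationDensity_le`). If there is a bound state, `μ`
stays below `-c² / 2`, and the eigenstates with `n ≥ 2 |E|` carry a density `O(1 / β)` uniformly in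
`η` (`exists_tsum_occupationDensity_le`); at low temperature the remaining density is shared by
`2 |E|` eigenstates, of which the ground state has the largest part.
-/

open MeasureTheory Filter
open scoped ComplexOrder

namespace QuantumGraph

/-! ### Integration by parts on an edge -/

theorem integral_deriv_eq_sub_of_Icc {a s t : ℝ} (hs : 0 ≤ s) (hst : s ≤ t) (hta : t ≤ a)
    {h h' : ℝ → ℂ} (hh : ∀ x ∈ Set.Icc 0 a, HasDerivWithinAt h (h' x) (Set.Icc 0 a) x)
    (hc : ContinuousOn h' (Set.Icc 0 a)) : ∫ x in s..t, h' x = h t - h s := by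
  have hsub : Set.Icc s t ⊆ Set.Icc 0 a := Set.Icc_subset_Icc hs hta
  refine intervalIntegral.integral_eq_sub_of_hasDerivAt_of_le hst ?_ ?_ ?_
  · exact fun x hx => ((hh x (hsub hx)).continuousWithinAt).mono hsub
  · intro x hx
    exact (hh x (hsub (Set.Ioo_subset_Icc_self hx))).hasDerivAt
      (Icc_mem_nhds (hs.trans_lt hx.1) (hx.2.trans_le hta))
  · exact (hc.mono (by rw [Set.uIcc_of_le hst]; exact hsub)).intervalIntegrable

/-- Integration by parts for a continuously differentiable `h` and the primitive of a merely
integrable `g`. Both sides are an integral over the triangle `0 < t ≤ x ≤ a`. -/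
theorem integral_deriv_mul_primitive {a : ℝ} (ha : 0 ≤ a) {g h h' : ℝ → ℂ}
    (hg : IntervalIntegrable g volume 0 a)
    (hh : ∀ x ∈ Set.Icc 0 a, HasDerivWithinAt h (h' x) (Set.Icc 0 a) x)
    (hc : ContinuousOn h' (Set.Icc 0 a)) :
    ∫ x in (0 : ℝ)..a, h' x * ∫ t in (0 : ℝ)..x, g t = ∫ t in (0 : ℝ)..a, (h a - h t) * g t := by
  have hgi : Integrable g (volume.restrict (Set.Ioc 0 a)) :=
    (intervalIntegrable_iff_integrableOn_Ioc_of_le ha).1 hg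
  have hhi : Integrable h' (volume.restrict (Set.Ioc 0 a)) :=
    (hc.integrableOn_Icc).mono_set Set.Ioc_subset_Icc_self
  have hprod := (hhi.mul_prod hgi).indicator
    (measurableSet_le measurable_snd measurable_fst : MeasurableSet {p : ℝ × ℝ | p.2 ≤ p.1})
  have key := integral_integral_swap
    (f := fun x t => Set.indicator {p : ℝ × ℝ | p.2 ≤ p.1} (fun p => h' p.1 * g p.2) (x, t)) hprod
  rw [intervalIntegral.integral_of_le ha, intervalIntegral.integral_of_le ha]
  convert key using 1
  · refine setIntegral_congr_fun measurableSet_Ioc fun x hx => ?_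
    have e : (fun t => Set.indicator {p : ℝ × ℝ | p.2 ≤ p.1} (fun p => h' p.1 * g p.2) (x, t)) =
        Set.indicator (Set.Iic x) (fun t => h' x * g t) := by
      ext t; simp [Set.indicator]
    simp only [e]
    rw [integral_indicator measurableSet_Iic, Measure.restrict_restrict measurableSet_Iic,
      integral_const_mul, intervalIntegral.integral_of_le hx.1.le]
    congr 4
    ext t; simp only [Set.mem_Ioc, Set.mem_inter_iff, Set.mem_Iic]
    constructor
    · rintro ⟨h1, h2⟩; exact ⟨h2, h1, h2.trans hx.2⟩
    · rintro ⟨h1, h2, h3⟩; exact ⟨h2, h1⟩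
  · refine setIntegral_congr_fun measurableSet_Ioc fun t ht => ?_
    have e : (fun x => Set.indicator {p : ℝ × ℝ | p.2 ≤ p.1} (fun p => h' p.1 * g p.2) (x, t)) =
        Set.indicator (Set.Ici t) (fun x => h' x * g t) := by
      ext x; simp [Set.indicator]
    simp only [e]
    rw [integral_indicator measurableSet_Ici, Measure.restrict_restrict measurableSet_Ici,
      integral_mul_const, ← integral_deriv_eq_sub_of_Icc ht.1.le ht.2 le_rfl hh hc,
      intervalIntegral.integral_of_le ht.2, ← integral_Icc_eq_integral_Ioc]
    congr 4
    ext x; simp only [Set.mem_Ioc, Set.mem_inter_iff, Set.mem_Ici, Set.mem_Icc]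
    constructor
    · rintro ⟨h1, h2⟩; exact ⟨h1, ht.1.trans_le h1, h2⟩
    · rintro ⟨h1, h2, h3⟩; exact ⟨h1, h3⟩

theorem memLp_two_of_continuousOn {a : ℝ} {u : ℝ → ℂ} (hu : ContinuousOn u (Set.Icc 0 a)) :
    MemLp u 2 (volume.restrict (Set.Ioo 0 a)) := by
  have h1 : MemLp u 2 (volume.restrict (Set.Icc 0 a)) := by
    obtain ⟨C, hC⟩ := isCompact_Icc.exists_bound_of_continuousOn hu
    refine MemLp.of_bound (hu.aestronglyMeasurable measurableSet_Icc) C ?_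
    exact (ae_restrict_iff' measurableSet_Icc).2 (ae_of_all _ hC)
  exact h1.mono_measure (Measure.restrict_mono_set _ Set.Ioo_subset_Icc_self)

namespace IsH2

variable {a : ℝ} {u du d2u v dv d2v : ℝ → ℂ}

theorem continuousOn (h : IsH2 a u du d2u) : ContinuousOn u (Set.Icc 0 a) :=
  fun x hx => (h.hasDerivWithinAt x hx).continuousWithinAt

theorem continuousOn_deriv (ha : 0 ≤ a) (h : IsH2 a u du d2u) :
    ContinuousOn du (Set.Icc 0 a) := by
  have h1 : ContinuousOn (fun x => ∫ t in (0 : ℝ)..x, d2u t) (Set.Icc 0 a) := by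
    have := intervalIntegral.continuousOn_primitive_interval'
      (h.intervalIntegrable ⟨ha, le_rfl⟩) (a := 0) (by simp)
    rwa [Set.uIcc_of_le ha] at this
  exact (continuousOn_const.add h1).congr fun x hx => h.integral_eq x hx

/-- Green's first identity on an edge. -/
theorem integral_conj_mul_neg_deriv2 (ha : 0 ≤ a) (hu : IsH2 a u du d2u) (hv : IsH2 a v dv d2v) :
    ∫ x in (0 : ℝ)..a, star (u x) * -d2v x =
      (∫ x in (0 : ℝ)..a, star (du x) * dv x) + (star (u 0) * dv 0 + star (u a) * -dv a) := by
  have hduc : ContinuousOn (fun x => star (du x)) (Set.Icc 0 a) := (hu.continuousOn_deriv ha).star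
  have hd : ∀ x ∈ Set.Icc 0 a,
      HasDerivWithinAt (fun x => star (u x)) (star (du x)) (Set.Icc 0 a) x :=
    fun x hx => (hu.hasDerivWithinAt x hx).star
  have hi := hv.intervalIntegrable ⟨ha, le_rfl⟩
  have hcu : ContinuousOn (fun x => star (u x)) (Set.uIcc 0 a) := by
    rw [Set.uIcc_of_le ha]; exact hu.continuousOn.star
  have h1 := integral_deriv_mul_primitive ha hi hd hduc
  have h2 := integral_deriv_eq_sub_of_Icc le_rfl ha le_rfl hd hduc
  have h3 : ∫ x in (0 : ℝ)..a, star (du x) * ∫ t in (0 : ℝ)..x, d2v t =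
      (∫ x in (0 : ℝ)..a, star (du x) * dv x) - (star (u a) - star (u 0)) * dv 0 := by
    rw [← h2, ← intervalIntegral.integral_mul_const, ← intervalIntegral.integral_sub]
    · refine intervalIntegral.integral_congr fun x hx => ?_
      rw [Set.uIcc_of_le ha] at hx
      simp only [hv.integral_eq x hx]
      ring
    · refine ContinuousOn.intervalIntegrable ?_
      rw [Set.uIcc_of_le ha]; exact hduc.mul (hv.continuousOn_deriv ha)
    · refine ContinuousOn.intervalIntegrable ?_
      rw [Set.uIcc_of_le ha]; exact hduc.mul continuousOn_const
  have h4 : ∫ t in (0 : ℝ)..a, (star (u a) - star (u t)) * d2v t =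
      star (u a) * (dv a - dv 0) + ∫ t in (0 : ℝ)..a, star (u t) * -d2v t := by
    rw [hv.integral_eq a ⟨ha, le_rfl⟩, add_sub_cancel_left, ← intervalIntegral.integral_const_mul,
      ← intervalIntegral.integral_add]
    · congr 1; ext t; ring
    · exact hi.const_mul _
    · exact hi.neg.continuousOn_mul hcu
  rw [h3, h4] at h1
  linear_combination -h1

end IsH2

/-! ### The quadratic form and Poincaré's inequality -/

section BoundaryData

variable {E : Type*} [Fintype E] [DecidableEq E] {P L : Matrix (E ⊕ E) (E ⊕ E) ℂ}

theorem IsBoundaryData.proj_mul (h : IsBoundaryData P L) : P * L = 0 := by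
  have h1 : P * (1 - P) = 0 := by rw [mul_sub, mul_one, h.proj_mul_self, sub_self]
  rw [← h.compress, mul_assoc (1 - P), ← mul_assoc, h1, zero_mul]

/-- The boundary condition splits into `P b = 0` and `(1 - P) b' = -L b`. -/
theorem IsBoundaryData.split (h : IsBoundaryData P L) {b b' : E ⊕ E → ℂ}
    (hb : (P + L).mulVec b + (1 - P).mulVec b' = 0) :
    P.mulVec b = 0 ∧ (1 - P).mulVec b' = -L.mulVec b := by
  have h1 : P.mulVec b = 0 := by
    have h2 := congrArg P.mulVec hb
    rw [Matrix.mulVec_add, Matrix.mulVec_mulVec, Matrix.mulVec_mulVec, mul_add, mul_sub,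
      h.proj_mul_self, h.proj_mul, mul_one, sub_self] at h2
    simpa using h2
  refine ⟨h1, ?_⟩
  rw [Matrix.add_mulVec, h1, zero_add] at hb
  exact eq_neg_of_add_eq_zero_right hb

/-- The boundary term of Green's identity, expressed by boundary values alone. -/
theorem IsBoundaryData.star_dotProduct (h : IsBoundaryData P L) {b b' c : E ⊕ E → ℂ}
    (hb : (P + L).mulVec b + (1 - P).mulVec b' = 0) (hc : P.mulVec c = 0) :
    star c ⬝ᵥ b' = -(star c ⬝ᵥ L.mulVec b) := by
  have h1 : (1 - P).mulVec c = c := by rw [Matrix.sub_mulVec, hc, Matrix.one_mulVec, sub_zero]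
  have h2 : (1 - P).IsHermitian := Matrix.isHermitian_one.sub h.proj_isHermitian
  conv_lhs => rw [← h1]
  rw [Matrix.star_mulVec, ← Matrix.dotProduct_mulVec, h2.eq, (h.split hb).2, dotProduct_neg]

end BoundaryData

section Inner

variable {E : Type*} [Fintype E] {l : E → ℝ}

theorem inner_eq_sum_integral (hl : ∀ e, 0 < l e) {ψ φ : L2 l} {u v : E → ℝ → ℂ}
    (hu : ∀ e, ψ e =ᵐ[volume.restrict (Set.Ioo 0 (l e))] u e)
    (hv : ∀ e, φ e =ᵐ[volume.restrict (Set.Ioo 0 (l e))] v e) :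
    inner ℂ ψ φ = ∑ e, ∫ x in (0 : ℝ)..l e, star (u e x) * v e x := by
  rw [PiLp.inner_apply]
  refine Finset.sum_congr rfl fun e _ => ?_
  rw [L2.inner_def, intervalIntegral.integral_of_le (hl e).le, integral_Ioc_eq_integral_Ioo]
  refine integral_congr_ae ?_
  filter_upwards [hu e, hv e] with x h1 h2
  rw [h1, h2, RCLike.inner_apply, mul_comm]
  rfl

theorem inner_self_eq_sum (hl : ∀ e, 0 < l e) {ψ : L2 l} {u : E → ℝ → ℂ}
    (hu : ∀ e, ψ e =ᵐ[volume.restrict (Set.Ioo 0 (l e))] u e) :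
    ‖ψ‖ ^ 2 = ∑ e, ∫ x in (0 : ℝ)..l e, ‖u e x‖ ^ 2 := by
  have h1 := inner_eq_sum_integral hl hu hu
  have h2 : ∀ e, ∫ x in (0 : ℝ)..l e, star (u e x) * u e x =
      ((∫ x in (0 : ℝ)..l e, ‖u e x‖ ^ 2 : ℝ) : ℂ) := by
    intro e
    rw [← intervalIntegral.integral_ofReal]
    congr 1; ext x
    rw [mul_comm, Complex.star_def, Complex.mul_conj, Complex.normSq_eq_norm_sq]
  simp only [h2] at h1
  rw [← inner_self_eq_norm_sq (𝕜 := ℂ), h1, ← Complex.ofReal_sum]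
  exact Complex.ofReal_re _

end Inner

section Graph

variable {E : Type*} [Fintype E] [DecidableEq E] {l : E → ℝ} {P L : Matrix (E ⊕ E) (E ⊕ E) ℂ}

/-- The functions `u`, `du`, `d2u` are the continuously differentiable representative of `p.1`, its
derivative and its second weak derivative, which witness that `p` is in the graph of `-Δ`. -/
structure IsRep (l : E → ℝ) (P L : Matrix (E ⊕ E) (E ⊕ E) ℂ) (p : L2 l × L2 l)
    (u du d2u : E → ℝ → ℂ) : Prop where
  isH2 : ∀ e, IsH2 (l e) (u e) (du e) (d2u e)
  fst_ae : ∀ e, p.1 e =ᵐ[volume.restrict (Set.Ioo 0 (l e))] u e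
  snd_ae : ∀ e, p.2 e =ᵐ[volume.restrict (Set.Ioo 0 (l e))] -d2u e
  boundary : (P + L).mulVec (boundaryValues l u) + (1 - P).mulVec (inwardDerivatives l du) = 0

theorem mem_laplacianGraph {p : L2 l × L2 l} :
    p ∈ laplacianGraph l P L ↔ ∃ u du d2u, IsRep l P L p u du d2u :=
  ⟨fun ⟨u, du, d2u, h1, h2, h3, h4⟩ => ⟨u, du, d2u, h1, h2, h3, h4⟩,
    fun ⟨u, du, d2u, h⟩ => ⟨u, du, d2u, h.1, h.2, h.3, h.4⟩⟩

/-- The quadratic form of `-Δ`, polarised. -/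
theorem IsRep.inner_eq (hPL : IsBoundaryData P L) (hl : ∀ e, 0 < l e) {p q : L2 l × L2 l}
    {u du d2u v dv d2v : E → ℝ → ℂ} (hp : IsRep l P L p u du d2u) (hq : IsRep l P L q v dv d2v) :
    inner ℂ p.1 q.2 = (∑ e, ∫ x in (0 : ℝ)..l e, star (du e x) * dv e x) -
      star (boundaryValues l u) ⬝ᵥ L.mulVec (boundaryValues l v) := by
  rw [inner_eq_sum_integral hl hp.fst_ae hq.snd_ae, sub_eq_add_neg,
    ← hPL.star_dotProduct hq.boundary (hPL.split hp.boundary).1]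
  simp only [Pi.neg_apply, (hp.isH2 _).integral_conj_mul_neg_deriv2 (hl _).le (hq.isH2 _)]
  rw [Finset.sum_add_distrib, Finset.sum_add_distrib]
  simp [dotProduct, boundaryValues, inwardDerivatives]

/-- `-Δ` is symmetric. -/
theorem inner_fst_snd_comm (hPL : IsBoundaryData P L) (hl : ∀ e, 0 < l e) {p q : L2 l × L2 l}
    (hp : p ∈ laplacianGraph l P L) (hq : q ∈ laplacianGraph l P L) :
    inner ℂ p.1 q.2 = inner ℂ p.2 q.1 := by
  obtain ⟨u, du, d2u, hp⟩ := mem_laplacianGraph.1 hp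
  obtain ⟨v, dv, d2v, hq⟩ := mem_laplacianGraph.1 hq
  rw [← inner_conj_symm p.2 q.1, hp.inner_eq hPL hl hq, hq.inner_eq hPL hl hp, map_sub, map_sum]
  congr 1
  · refine Finset.sum_congr rfl fun e _ => ?_
    rw [intervalIntegral.integral_of_le (hl e).le, intervalIntegral.integral_of_le (hl e).le,
      ← integral_conj]
    congr 1; ext x; simp [mul_comm]
  · change _ = star _
    rw [Matrix.star_dotProduct, Matrix.star_mulVec, hPL.isHermitian.eq,
      ← Matrix.dotProduct_mulVec]

theorem IsRep.re_inner_self (hPL : IsBoundaryData P L) (hl : ∀ e, 0 < l e) {p : L2 l × L2 l}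
    {u du d2u : E → ℝ → ℂ} (hp : IsRep l P L p u du d2u) :
    (inner ℂ p.1 p.2).re = (∑ e, ∫ x in (0 : ℝ)..l e, ‖du e x‖ ^ 2) -
      (star (boundaryValues l u) ⬝ᵥ L.mulVec (boundaryValues l u)).re := by
  have h2 : ∀ e, ∫ x in (0 : ℝ)..l e, star (du e x) * du e x =
      ((∫ x in (0 : ℝ)..l e, ‖du e x‖ ^ 2 : ℝ) : ℂ) := by
    intro e
    rw [← intervalIntegral.integral_ofReal]
    congr 1; ext x
    rw [mul_comm, Complex.star_def, Complex.mul_conj, Complex.normSq_eq_norm_sq]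
  rw [hp.inner_eq hPL hl hp]
  simp only [h2, Complex.sub_re]
  congr 1
  rw [← Complex.ofReal_sum, Complex.ofReal_re]

theorem re_inner_nonneg (hPL : IsBoundaryData P L) (hl : ∀ e, 0 < l e) (hL : (-L).PosSemidef)
    {p : L2 l × L2 l} (hp : p ∈ laplacianGraph l P L) : 0 ≤ (inner ℂ p.1 p.2).re := by
  obtain ⟨u, du, d2u, hp⟩ := mem_laplacianGraph.1 hp
  rw [hp.re_inner_self hPL hl]
  have h1 := hL.re_dotProduct_nonneg (boundaryValues l u)
  rw [Matrix.neg_mulVec, dotProduct_neg] at h1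
  have h2 : (0 : ℝ) ≤ ∑ e, ∫ x in (0 : ℝ)..l e, ‖du e x‖ ^ 2 :=
    Finset.sum_nonneg fun e _ => intervalIntegral.integral_nonneg (hl e).le fun x _ => by positivity
  have h3 : (0 : ℝ) ≤ -(star (boundaryValues l u) ⬝ᵥ L.mulVec (boundaryValues l u)).re := by
    simpa using h1
  linarith

end Graph

/-- Poincaré's inequality for a function that vanishes at the left end point. -/
theorem integral_norm_sq_le_of_left_eq_zero {a b : ℝ} (hab : a ≤ b) {u du : ℝ → ℂ}
    (hd : ∀ x ∈ Set.Icc a b, HasDerivWithinAt u (du x) (Set.Icc a b) x)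
    (hc : ContinuousOn du (Set.Icc a b)) (h0 : u a = 0) :
    ∫ x in a..b, ‖u x‖ ^ 2 ≤ (b - a) ^ 2 * ∫ x in a..b, ‖du x‖ ^ 2 := by
  set D := ∫ x in a..b, ‖du x‖ ^ 2 with hD
  have hn : ContinuousOn (fun x => ‖du x‖) (Set.Icc a b) := hc.norm
  have hpt : ∀ x ∈ Set.Icc a b, ‖u x‖ ^ 2 ≤ (b - a) * D := by
    intro x hx
    have hsub : Set.Icc a x ⊆ Set.Icc a b := Set.Icc_subset_Icc_right hx.2
    have hi : ∀ {f : ℝ → ℝ}, ContinuousOn f (Set.Icc a b) → IntervalIntegrable f volume a x := by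
      intro f hf
      refine ContinuousOn.intervalIntegrable ?_
      rw [Set.uIcc_of_le hx.1]; exact hf.mono hsub
    have h1 : ∫ t in a..x, du t = u x := by
      rw [intervalIntegral.integral_eq_sub_of_hasDerivAt_of_le hx.1 (f := u), h0, sub_zero]
      · exact fun y hy => ((hd y (hsub hy)).continuousWithinAt).mono hsub
      · exact fun y hy => (hd y (hsub (Set.Ioo_subset_Icc_self hy))).hasDerivAt
          (Icc_mem_nhds hy.1 (hy.2.trans_le hx.2))
      · refine ContinuousOn.intervalIntegrable ?_
        rw [Set.uIcc_of_le hx.1]; exact hc.mono hsub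
    have h2 : ‖u x‖ ≤ ∫ t in a..x, ‖du t‖ := by
      rw [← h1]; exact intervalIntegral.norm_integral_le_integral_norm hx.1
    set I := ∫ t in a..x, ‖du t‖
    set J := ∫ t in a..x, ‖du t‖ ^ 2 with hJ
    have hJD : J ≤ D := by
      refine intervalIntegral.integral_mono_interval le_rfl hx.1 hx.2
        (ae_of_all _ fun t => by positivity) ?_
      refine ContinuousOn.intervalIntegrable ?_
      rw [Set.uIcc_of_le hab]; exact hn.pow 2
    have hJ0 : 0 ≤ J := intervalIntegral.integral_nonneg hx.1 fun t _ => by positivity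
    -- Cauchy–Schwarz, from `0 ≤ ∫ ((x - a) ‖du‖ - I) ^ 2`
    have h3 : 0 ≤ (x - a) ^ 2 * J - 2 * ((x - a) * I) * I + (x - a) * I ^ 2 := by
      have h4 : 0 ≤ ∫ t in a..x, ((x - a) * ‖du t‖ - I) ^ 2 :=
        intervalIntegral.integral_nonneg hx.1 fun t _ => by positivity
      have h5 : ∫ t in a..x, ((x - a) * ‖du t‖ - I) ^ 2 =
          ∫ t in a..x, ((x - a) ^ 2 * ‖du t‖ ^ 2 - 2 * ((x - a) * I) * ‖du t‖ + I ^ 2) := by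
        congr 1; ext t; ring
      rw [h5, intervalIntegral.integral_add, intervalIntegral.integral_sub,
        intervalIntegral.integral_const_mul, intervalIntegral.integral_const_mul,
        intervalIntegral.integral_const, smul_eq_mul] at h4
      · exact h4
      · exact (hi (hn.pow 2)).const_mul _
      · exact (hi hn).const_mul _
      · exact ((hi (hn.pow 2)).const_mul _).sub ((hi hn).const_mul _)
      · exact intervalIntegrable_const
    rcases hx.1.eq_or_lt with h | h
    · rw [← h, h0]
      simp only [norm_zero, ne_eq, OfNat.ofNat_ne_zero, not_false_eq_true, zero_pow]
      exact mul_nonneg (by linarith) (hJ0.trans hJD)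
    · have h6 : I ^ 2 ≤ (x - a) * J := by
        have h7 : 0 < x - a := sub_pos.2 h
        have : 0 ≤ (x - a) * ((x - a) * J - I ^ 2) := by linarith
        linarith [nonneg_of_mul_nonneg_right this h7]
      calc ‖u x‖ ^ 2 ≤ I ^ 2 := by gcongr
        _ ≤ (x - a) * J := h6
        _ ≤ (b - a) * D := mul_le_mul (by linarith [hx.2]) hJD hJ0 (by linarith)
  calc ∫ x in a..b, ‖u x‖ ^ 2 ≤ ∫ _ in a..b, (b - a) * D := by
        refine intervalIntegral.integral_mono_on hab ?_ intervalIntegrable_const hpt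
        refine ContinuousOn.intervalIntegrable ?_
        rw [Set.uIcc_of_le hab]
        exact (ContinuousOn.norm fun x hx => (hd x hx).continuousWithinAt).pow 2
    _ = (b - a) ^ 2 * D := by rw [intervalIntegral.integral_const, smul_eq_mul]; ring

/-- The `j`-th of the points that divide `[0, a]` into `M + 1` intervals of equal length. -/
noncomputable def node (M : ℕ) (a : ℝ) (j : ℕ) : ℝ := j * (a / (M + 1))

theorem node_mem {M : ℕ} {a : ℝ} (ha : 0 ≤ a) {j : ℕ} (hj : j ≤ M + 1) :
    node M a j ∈ Set.Icc 0 a := by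
  have h1 : (0 : ℝ) < M + 1 := by positivity
  have h2 : (j : ℝ) ≤ M + 1 := by exact_mod_cast hj
  refine ⟨by unfold node; positivity, ?_⟩
  unfold node
  rw [mul_div_assoc', div_le_iff₀ h1, mul_comm]
  gcongr

theorem IsH2.integral_norm_sq_le_of_node {a : ℝ} (ha : 0 < a) {u du d2u : ℝ → ℂ}
    (hu : IsH2 a u du d2u) (M : ℕ) (h0 : ∀ j ≤ M, u (node M a j) = 0) :
    ∫ x in (0 : ℝ)..a, ‖u x‖ ^ 2 ≤ (a / (M + 1)) ^ 2 * ∫ x in (0 : ℝ)..a, ‖du x‖ ^ 2 := by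
  have hmono : ∀ j, node M a j ≤ node M a (j + 1) := by
    intro j; unfold node; push_cast; gcongr; linarith
  have hsub : ∀ j < M + 1, Set.Icc (node M a j) (node M a (j + 1)) ⊆ Set.Icc 0 a := fun j hj =>
    Set.Icc_subset_Icc (node_mem ha.le hj.le).1 (node_mem ha.le hj).2
  have hi : ∀ {f : ℝ → ℂ}, ContinuousOn f (Set.Icc 0 a) → ∀ j < M + 1,
      IntervalIntegrable (fun x => ‖f x‖ ^ 2) volume (node M a j) (node M a (j + 1)) := by
    intro f hf j hj
    refine ContinuousOn.intervalIntegrable ?_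
    rw [Set.uIcc_of_le (hmono j)]
    exact (hf.norm.pow 2).mono (hsub j hj)
  have h00 : node M a 0 = 0 := by simp [node]
  have h11 : node M a (M + 1) = a := by unfold node; push_cast; field_simp
  have e1 := intervalIntegral.sum_integral_adjacent_intervals (hi hu.continuousOn)
  have e2 := intervalIntegral.sum_integral_adjacent_intervals (hi (hu.continuousOn_deriv ha.le))
  rw [h00, h11] at e1 e2
  rw [← e1, ← e2, Finset.mul_sum]
  refine Finset.sum_le_sum fun j hj => ?_
  have hj := Finset.mem_range.1 hj
  have h := integral_norm_sq_le_of_left_eq_zero (hmono j)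
    (fun x hx => (hu.hasDerivWithinAt x (hsub j hj hx)).mono (hsub j hj))
    ((hu.continuousOn_deriv ha.le).mono (hsub j hj)) (h0 j (by omega))
  have hd : node M a (j + 1) - node M a j = a / (M + 1) := by unfold node; push_cast; ring
  rwa [hd] at h

variable {E : Type*} [Fintype E] [DecidableEq E] {l : E → ℝ} {P L : Matrix (E ⊕ E) (E ⊕ E) ℂ}

/-- On functions that vanish at all nodes the quadratic form is that of decoupled short
intervals with Dirichlet conditions, which is large. -/
theorem IsRep.norm_sq_le_of_node (hPL : IsBoundaryData P L) (hl : ∀ e, 0 < l e) {R : ℝ}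
    (hR : ∀ e, l e ≤ R) {p : L2 l × L2 l} {u du d2u : E → ℝ → ℂ} (hp : IsRep l P L p u du d2u)
    (M : ℕ) (h0 : ∀ e, ∀ j ≤ M + 1, u e (node M (l e) j) = 0) :
    ‖p.1‖ ^ 2 ≤ (R / (M + 1)) ^ 2 * (inner ℂ p.1 p.2).re := by
  have hb : boundaryValues l u = 0 := by
    ext i
    rcases i with e | e
    · simpa [boundaryValues, node] using h0 e 0 (by omega)
    · have h := h0 e (M + 1) le_rfl
      have h11 : node M (l e) (M + 1) = l e := by unfold node; push_cast; field_simp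
      rw [h11] at h
      simpa [boundaryValues] using h
  rw [hp.re_inner_self hPL hl, hb, Matrix.mulVec_zero, dotProduct_zero, Complex.zero_re, sub_zero,
    inner_self_eq_sum hl hp.fst_ae, Finset.mul_sum]
  refine Finset.sum_le_sum fun e _ => ?_
  refine ((hp.isH2 e).integral_norm_sq_le_of_node (hl e) M
    fun j hj => h0 e j (by omega)).trans ?_
  have h1 : 0 ≤ ∫ x in (0 : ℝ)..l e, ‖du e x‖ ^ 2 :=
    intervalIntegral.integral_nonneg (hl e).le fun x _ => by positivity
  have := hR e
  have := hl e
  gcongr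

/-! ### Evaluation at nodes and lower bounds for eigenvalues -/

section NodeEvaluation

variable {E : Type*} [Fintype E] [DecidableEq E] {l : E → ℝ} {P L : Matrix (E ⊕ E) (E ⊕ E) ℂ}

/-- The continuously differentiable representative of the first component of an element of the
graph of `-Δ`. -/
noncomputable def rep (p : laplacianGraph l P L) : E → ℝ → ℂ := (mem_laplacianGraph.1 p.2).choose

theorem isRep_rep (p : laplacianGraph l P L) : ∃ du d2u, IsRep l P L p.1 (rep p) du d2u :=
  (mem_laplacianGraph.1 p.2).choose_spec

theorem rep_eqOn (hl : ∀ e, 0 < l e) (p : laplacianGraph l P L) {e : E} {v : ℝ → ℂ}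
    (hv : p.1.1 e =ᵐ[volume.restrict (Set.Ioo 0 (l e))] v)
    (hc : ContinuousOn v (Set.Icc 0 (l e))) : Set.EqOn (rep p e) v (Set.Icc 0 (l e)) := by
  obtain ⟨du, d2u, h⟩ := isRep_rep p
  refine Measure.eqOn_Icc_of_ae_eq volume (hl e).ne ?_ (h.isH2 e).continuousOn hc
  rw [← restrict_Ioo_eq_restrict_Icc]
  exact (h.fst_ae e).symm.trans hv

/-- Evaluation of functions in the domain of `-Δ` at all nodes, as a linear map. -/
noncomputable def nodeEval (hl : ∀ e, 0 < l e) (M : ℕ) :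
    laplacianGraph l P L →ₗ[ℂ] (E × Fin (M + 2) → ℂ) where
  toFun p i := rep p i.1 (node M (l i.1) i.2)
  map_add' p q := by
    ext i
    obtain ⟨du, d2u, hp⟩ := isRep_rep p
    obtain ⟨dv, d2v, hq⟩ := isRep_rep q
    refine rep_eqOn hl (p + q) (v := rep p i.1 + rep q i.1) ?_
      ((hp.isH2 _).continuousOn.add (hq.isH2 _).continuousOn)
      (node_mem (hl _).le (Nat.lt_succ_iff.1 i.2.2))
    filter_upwards [hp.fst_ae i.1, hq.fst_ae i.1, Lp.coeFn_add (p.1.1 i.1) (q.1.1 i.1)]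
      with x h1 h2 h3
    simp only [Submodule.coe_add, Prod.fst_add, PiLp.add_apply, Pi.add_apply] at *
    rw [h3, h1, h2]
  map_smul' c p := by
    ext i
    obtain ⟨du, d2u, hp⟩ := isRep_rep p
    refine rep_eqOn hl (c • p) (v := c • rep p i.1) ?_
      ((hp.isH2 _).continuousOn.const_smul c)
      (node_mem (hl _).le (Nat.lt_succ_iff.1 i.2.2))
    filter_upwards [hp.fst_ae i.1, Lp.coeFn_smul c (p.1.1 i.1)] with x h1 h3
    simp only [Submodule.coe_smul, Prod.smul_fst, PiLp.smul_apply, Pi.smul_apply] at *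
    rw [h3, h1]

theorem norm_sq_le_of_nodeEval_eq_zero (hPL : IsBoundaryData P L) (hl : ∀ e, 0 < l e) {R : ℝ}
    (hR : ∀ e, l e ≤ R) (M : ℕ) {p : laplacianGraph l P L} (h0 : nodeEval hl M p = 0) :
    ‖p.1.1‖ ^ 2 ≤ (R / (M + 1)) ^ 2 * (inner ℂ p.1.1 p.1.2).re := by
  obtain ⟨du, d2u, hp⟩ := isRep_rep p
  exact hp.norm_sq_le_of_node hPL hl hR M fun e j hj =>
    congrFun h0 (e, ⟨j, Nat.lt_succ_iff.2 hj⟩)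

end NodeEvaluation

theorem inner_sum_smul_sum_smul {H ι : Type*} [NormedAddCommGroup H] [InnerProductSpace ℂ H]
    (s : Finset ι) {g : ι → H} (hg : ∀ i ∈ s, ∀ j ∈ s, i ≠ j → inner ℂ (g i) (g j) = 0)
    (a b : ι → ℝ) :
    inner ℂ (∑ i ∈ s, (a i : ℂ) • g i) (∑ i ∈ s, (b i : ℂ) • g i) =
      ((∑ i ∈ s, a i * b i * ‖g i‖ ^ 2 : ℝ) : ℂ) := by
  rw [sum_inner, Complex.ofReal_sum]
  refine Finset.sum_congr rfl fun i hi => ?_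
  rw [inner_sum, Finset.sum_eq_single i]
  · rw [inner_smul_left, inner_smul_right, inner_self_eq_norm_sq_to_K]
    simp [mul_assoc]
  · intro j hj hij
    rw [inner_smul_left, inner_smul_right, hg i hi j hj hij.symm, mul_zero, mul_zero]
  · exact fun h => absurd hi h

section Eigenspace

variable {E : Type*} [Fintype E] [DecidableEq E] {l : E → ℝ} {P L : Matrix (E ⊕ E) (E ⊕ E) ℂ}

theorem mem_eigenspace {κ : ℝ} {f : L2 l} :
    f ∈ eigenspace l P L κ ↔ (f, (κ : ℂ) • f) ∈ laplacianGraph l P L := Iff.rfl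

theorem inner_eigenspace_eq_zero (hPL : IsBoundaryData P L) (hl : ∀ e, 0 < l e) {κ κ' : ℝ}
    (hne : κ ≠ κ') {f g : L2 l} (hf : f ∈ eigenspace l P L κ) (hg : g ∈ eigenspace l P L κ') :
    inner ℂ f g = 0 := by
  have h := inner_fst_snd_comm hPL hl (mem_eigenspace.1 hf) (mem_eigenspace.1 hg)
  simp only [inner_smul_left, inner_smul_right, Complex.conj_ofReal] at h
  have h2 : ((κ' : ℂ) - κ) * inner ℂ f g = 0 := by rw [sub_mul, h, sub_self]
  refine (mul_eq_zero.1 h2).resolve_left ?_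
  exact_mod_cast sub_ne_zero.2 hne.symm

/-- Eigenfunctions span a space on which the quadratic form is small, hence which contains only
few functions vanishing at all nodes. -/
theorem one_le_of_linearIndependent (hPL : IsBoundaryData P L) (hl : ∀ e, 0 < l e) {R : ℝ}
    (hR : ∀ e, l e ≤ R) {M n : ℕ} (hn : (M + 2) * Fintype.card E ≤ n) {x : ℝ}
    {f : Fin (n + 1) → L2 l} (hf : LinearIndependent ℂ f)
    (hfx : ∀ i, ∃ κ ≤ x, f i ∈ eigenspace l P L κ) : 1 ≤ (R / (M + 1)) ^ 2 * x := by
  choose κ hκ hfκ using hfx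
  let p : Fin (n + 1) → laplacianGraph l P L := fun i => ⟨_, mem_eigenspace.1 (hfκ i)⟩
  let T : (Fin (n + 1) → ℂ) →ₗ[ℂ] laplacianGraph l P L := Fintype.linearCombination ℂ p
  have hker : LinearMap.ker (nodeEval hl M ∘ₗ T) ≠ ⊥ := by
    refine LinearMap.ker_ne_bot_of_finrank_lt ?_
    simp only [Module.finrank_fintype_fun_eq_card, Fintype.card_prod, Fintype.card_fin]
    rw [mul_comm]; omega
  obtain ⟨c, hc, hc0⟩ := (Submodule.ne_bot_iff _).1 hker
  have hmain := norm_sq_le_of_nodeEval_eq_zero hPL hl hR M (p := T c) hc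
  have e1 : (T c).1.1 = ∑ i, c i • f i := by
    simp [T, Fintype.linearCombination_apply, p, Prod.fst_sum]
  have e2 : (T c).1.2 = ∑ i, c i • (κ i : ℂ) • f i := by
    simp [T, Fintype.linearCombination_apply, p, Prod.snd_sum]
  have hne : (T c).1.1 ≠ 0 := by
    rw [e1]
    intro h
    exact hc0 (funext (Fintype.linearIndependent_iff.1 hf c h))
  -- group the eigenfunctions according to their eigenvalue
  let K : Finset ℝ := Finset.univ.image κ
  let g : ℝ → L2 l := fun k => ∑ i with κ i = k, c i • f i
  have hg : ∀ k, g k ∈ eigenspace l P L k := fun k =>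
    Submodule.sum_mem _ fun i hi => Submodule.smul_mem _ _ ((Finset.mem_filter.1 hi).2 ▸ hfκ i)
  have hmaps : ∀ i ∈ (Finset.univ : Finset (Fin (n + 1))), κ i ∈ K := fun i hi =>
    Finset.mem_image_of_mem _ hi
  have e3 : (T c).1.1 = ∑ k ∈ K, ((1 : ℝ) : ℂ) • g k := by
    rw [e1, ← Finset.sum_fiberwise_of_maps_to hmaps]
    simp [g]
  have e4 : (T c).1.2 = ∑ k ∈ K, (k : ℂ) • g k := by
    rw [e2, ← Finset.sum_fiberwise_of_maps_to hmaps]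
    refine Finset.sum_congr rfl fun k _ => ?_
    rw [Finset.smul_sum]
    refine Finset.sum_congr rfl fun i hi => ?_
    rw [(Finset.mem_filter.1 hi).2, smul_comm]
  have hort : ∀ i ∈ K, ∀ j ∈ K, i ≠ j → inner ℂ (g i) (g j) = 0 := fun i _ j _ hij =>
    inner_eigenspace_eq_zero hPL hl hij (hg i) (hg j)
  have hle : (inner ℂ (T c).1.1 (T c).1.2).re ≤ x * ‖(T c).1.1‖ ^ 2 := by
    have h1 : ‖(T c).1.1‖ ^ 2 = ∑ k ∈ K, 1 * 1 * ‖g k‖ ^ 2 := by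
      rw [← inner_self_eq_norm_sq (𝕜 := ℂ), e3, inner_sum_smul_sum_smul K hort (fun _ => 1)]
      exact Complex.ofReal_re _
    rw [h1, e3, e4, inner_sum_smul_sum_smul K hort (fun _ => 1), Complex.ofReal_re, Finset.mul_sum]
    refine Finset.sum_le_sum fun k hk => ?_
    obtain ⟨i, _, rfl⟩ := Finset.mem_image.1 hk
    simp only [one_mul]
    exact mul_le_mul_of_nonneg_right (hκ i) (by positivity)
  have hpos : 0 < ‖(T c).1.1‖ ^ 2 := by positivity
  have h5 : ‖(T c).1.1‖ ^ 2 ≤ (R / (M + 1)) ^ 2 * x * ‖(T c).1.1‖ ^ 2 :=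
    hmain.trans (by rw [mul_assoc]; gcongr)
  by_contra hlt
  push Not at hlt
  nlinarith

/-- The eigenvalues are bounded below. The grid argument allows only `2 |E|` linearly independent
eigenfunctions with non-positive eigenvalue, so there are finitely many such eigenvalues. -/
theorem exists_lt_eigenvalues [Nonempty E] (hPL : IsBoundaryData P L) (hl : ∀ e, 0 < l e) :
    ∃ s : ℝ, 0 < s ∧ ∀ κ, eigenspace l P L κ ≠ ⊥ → -s < κ := by
  have hfin : {κ : ℝ | κ ≤ 0 ∧ eigenspace l P L κ ≠ ⊥}.Finite := by
    by_contra hinf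
    have hinf : {κ : ℝ | κ ≤ 0 ∧ eigenspace l P L κ ≠ ⊥}.Infinite := hinf
    let κ : ℕ → ℝ := fun n => hinf.natEmbedding _ n
    have hκ : ∀ n, κ n ≤ 0 ∧ eigenspace l P L (κ n) ≠ ⊥ := fun n => (hinf.natEmbedding _ n).2
    have hinj : Function.Injective κ := fun a b h => (hinf.natEmbedding _).injective (Subtype.ext h)
    have hv : ∀ n, ∃ f ∈ eigenspace l P L (κ n), f ≠ 0 :=
      fun n => (Submodule.ne_bot_iff _).1 (hκ n).2
    choose f hf hf0 using hv
    obtain ⟨R, hR⟩ := (Set.finite_range l).bddAbove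
    have hli : LinearIndependent ℂ
        (fun i : Fin ((0 + 2) * Fintype.card E + 1) => f i) := by
      refine linearIndependent_of_ne_zero_of_inner_eq_zero (fun i => hf0 i) fun i j hij => ?_
      exact inner_eigenspace_eq_zero hPL hl
        (fun h => hij (Fin.ext (hinj h))) (hf i) (hf j)
    have := one_le_of_linearIndependent hPL hl (fun e => hR ⟨e, rfl⟩) le_rfl hli (x := 0)
      fun i => ⟨κ i, (hκ i).1, hf i⟩
    norm_num at this
  obtain ⟨b, hb⟩ := hfin.bddBelow
  refine ⟨|b| + 1, by positivity, fun κ hκ => ?_⟩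
  by_cases h : κ ≤ 0
  · linarith [hb ⟨h, hκ⟩, neg_abs_le b]
  · linarith [abs_nonneg b]

end Eigenspace

/-! ### A differential equation and a criterion for compactness -/

section ODE

theorem IsH2.of_hasDerivAt_off_countable {a : ℝ} {u du d2u : ℝ → ℂ} {s : Set ℝ}
    (hs : s.Countable) (hu : ∀ x, HasDerivAt u (du x) x) (hc : Continuous du)
    (hdu : ∀ x ∉ s, HasDerivAt du (d2u x) x)
    (hm : MemLp d2u 2 (volume.restrict (Set.Ioo 0 a))) : IsH2 a u du d2u where
  hasDerivWithinAt x _ := (hu x).hasDerivWithinAt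
  memLp := hm
  integral_eq x hx := by
    have hi : IntervalIntegrable d2u volume 0 x := by
      rw [intervalIntegrable_iff_integrableOn_Ioo_of_le hx.1]
      have h1 : IntegrableOn d2u (Set.Ioo 0 a) volume := hm.integrable (by norm_num)
      exact h1.mono_set (Set.Ioo_subset_Ioo_right hx.2)
    rw [integral_eq_of_hasDerivAt_off_countable_of_le du d2u hx.1 hs hc.continuousOn
      (fun y hy => hdu y hy.2) hi]
    ring

theorem IsH2.of_hasDerivAt {a : ℝ} {u du d2u : ℝ → ℂ}
    (hu : ∀ x, HasDerivAt u (du x) x) (hdu : ∀ x, HasDerivAt du (d2u x) x)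
    (hc : Continuous d2u) : IsH2 a u du d2u :=
  .of_hasDerivAt_off_countable Set.countable_empty hu
    (continuous_iff_continuousAt.2 fun x => (hdu x).continuousAt) (fun x _ => hdu x)
    (memLp_two_of_continuousOn hc.continuousOn)

/-- A particular solution of `-u'' + σ² u = f`, obtained by solving `w' - σ w = -f` and then
`u' + σ u = w`. -/
theorem exists_isH2_solution {a σ : ℝ} {f : ℝ → ℂ}
    (hf : MemLp f 2 (volume.restrict (Set.Ioo 0 a))) :
    ∃ u du d2u : ℝ → ℂ, IsH2 a u du d2u ∧
      d2u =ᵐ[volume.restrict (Set.Ioo 0 a)] fun x => (σ : ℂ) ^ 2 * u x - f x := by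
  set F : ℝ → ℂ := Set.indicator (Set.Ioo 0 a) f with hF
  have hFf : F =ᵐ[volume.restrict (Set.Ioo 0 a)] f := indicator_ae_eq_restrict measurableSet_Ioo
  have hFm : MemLp F 2 (volume.restrict (Set.Ioo 0 a)) := hf.ae_eq hFf.symm
  have hFi : Integrable F volume :=
    (integrable_indicator_iff measurableSet_Ioo).2
      (hf.integrable (by norm_num) : IntegrableOn f _ _)
  let e : ℝ → ℝ → ℂ := fun τ x => ((Real.exp (τ * x) : ℝ) : ℂ)
  have he : ∀ τ x, HasDerivAt (e τ) (τ * e τ x) x := by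
    intro τ x
    have h1 : HasDerivAt (fun x : ℝ => Real.exp (τ * x)) (Real.exp (τ * x) * (τ * 1)) x :=
      ((hasDerivAt_id x).const_mul τ).exp
    convert h1.ofReal_comp using 1
    simp only [e]; push_cast; ring
  have hec : ∀ τ, Continuous (e τ) := fun τ =>
    continuous_iff_continuousAt.2 fun x => (he τ x).continuousAt
  have hinv : ∀ x, e σ x * e (-σ) x = 1 := by
    intro x
    simp only [e]
    rw [← Complex.ofReal_mul, ← Real.exp_add]
    simp
  have hgi : ∀ x y, IntervalIntegrable (fun t => e (-σ) t * F t) volume x y := fun x y =>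
    hFi.intervalIntegrable.continuousOn_mul (hec _).continuousOn
  let G : ℝ → ℂ := fun x => ∫ t in (0 : ℝ)..x, e (-σ) t * F t
  have hGc : Continuous G := intervalIntegral.continuous_primitive hgi 0
  let w : ℝ → ℂ := fun x => -(e σ x * G x)
  have hwc : Continuous w := ((hec σ).mul hGc).neg
  have hw : ∀ x, 0 ≤ x → w x = ∫ t in (0 : ℝ)..x, (σ * w t - F t) := by
    intro x hx
    have h1 := integral_deriv_mul_primitive hx (hgi 0 x) (h := e σ) (h' := fun x => σ * e σ x)
      (fun y _ => (he σ y).hasDerivWithinAt) (continuous_const.mul (hec σ)).continuousOn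
    have h2 : ∀ t, (e σ x - e σ t) * (e (-σ) t * F t) = e σ x * (e (-σ) t * F t) - F t := by
      intro t; linear_combination -F t * hinv t
    simp only [h2] at h1
    rw [intervalIntegral.integral_sub ((hgi 0 x).const_mul _) hFi.intervalIntegrable,
      intervalIntegral.integral_const_mul] at h1
    rw [intervalIntegral.integral_sub _ hFi.intervalIntegrable]
    · have h3 : ∀ t, (σ : ℂ) * w t = -(σ * e σ t * G t) := by intro t; simp only [w]; ring
      simp only [h3]
      rw [intervalIntegral.integral_neg, h1]
      simp only [w, G]; ring
    · exact (continuous_const.mul hwc).intervalIntegrable 0 x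
  let u : ℝ → ℂ := fun x => e (-σ) x * ∫ t in (0 : ℝ)..x, e σ t * w t
  have hud : ∀ x, HasDerivAt u (w x - σ * u x) x := by
    intro x
    have h1 := (he (-σ) x).mul
      (((hec σ).mul hwc).integral_hasStrictDerivAt 0 x).hasDerivAt
    refine h1.congr_deriv ?_
    simp only [u, Pi.mul_apply]; push_cast
    linear_combination w x * hinv x
  have huc : Continuous u := continuous_iff_continuousAt.2 fun x => (hud x).continuousAt
  have hu0 : u 0 = 0 := by simp [u]
  have hw0 : w 0 = 0 := by simp [w, G]
  refine ⟨u, fun x => w x - σ * u x, fun x => (σ : ℂ) ^ 2 * u x - F x, ⟨?_, ?_, ?_⟩, ?_⟩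
  · exact fun x _ => (hud x).hasDerivWithinAt
  · exact (memLp_two_of_continuousOn (continuous_const.mul huc).continuousOn).sub hFm
  · intro x hx
    have h1 : u x = ∫ t in (0 : ℝ)..x, (w t - σ * u t) := by
      rw [intervalIntegral.integral_eq_sub_of_hasDerivAt (fun y _ => hud y), hu0, sub_zero]
      exact (hwc.sub (continuous_const.mul huc)).intervalIntegrable 0 x
    have h2 : ∀ t, (σ : ℂ) ^ 2 * u t - F t = (σ * w t - F t) - σ * (w t - σ * u t) := by
      intro t; ring
    simp only [h2, hu0, hw0]
    rw [intervalIntegral.integral_sub, intervalIntegral.integral_const_mul, ← h1, ← hw x hx.1]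
    · ring
    · exact ((continuous_const.mul hwc).intervalIntegrable 0 x).sub hFi.intervalIntegrable
    · exact (continuous_const.mul (hwc.sub (continuous_const.mul huc))).intervalIntegrable 0 x
  · filter_upwards [hFf] with x hx
    rw [hx]

end ODE

section CompactOperator

variable {H : Type*} [NormedAddCommGroup H] [InnerProductSpace ℂ H] [CompleteSpace H]

/-- An operator that is arbitrarily small on subspaces of finite codimension is compact. The
subspaces need not be closed. -/
theorem isCompactOperator_of_small_on_finite_codim {T : H →L[ℂ] H}
    (hT : ∀ ε > 0, ∃ V : Submodule ℂ H, FiniteDimensional ℂ (H ⧸ V) ∧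
      ∀ x ∈ V, ‖T x‖ ≤ ε * ‖x‖) : IsCompactOperator T := by
  have happrox : ∀ ε > 0, ∃ S : H →L[ℂ] H, IsCompactOperator S ∧ ‖S - T‖ ≤ ε := by
    intro ε hε
    obtain ⟨V, hV, hVT⟩ := hT ε hε
    have hcl : ∀ x ∈ V.topologicalClosure, ‖T x‖ ≤ ε * ‖x‖ := by
      intro x hx
      have hclosed : IsClosed {x : H | ‖T x‖ ≤ ε * ‖x‖} :=
        isClosed_le (by fun_prop) (by fun_prop)
      exact closure_minimal hVT hclosed hx
    set W := V.topologicalClosure with hW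
    have : CompleteSpace W := V.isClosed_topologicalClosure.completeSpace_coe
    have hfin : FiniteDimensional ℂ Wᗮ := by
      refine FiniteDimensional.of_injective (V.mkQ ∘ₗ Wᗮ.subtype) ?_
      rw [← LinearMap.ker_eq_bot, LinearMap.ker_eq_bot']
      intro x hx
      have hxV : (x : H) ∈ V := (Submodule.Quotient.mk_eq_zero V).1 hx
      have h0 : inner ℂ (x : H) (x : H) = 0 :=
        (Submodule.mem_orthogonal _ _).1 x.2 x (V.le_topologicalClosure hxV)
      exact Subtype.ext (inner_self_eq_zero.1 h0)
    refine ⟨T ∘L Wᗮ.starProjection, ?_, ?_⟩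
    · have h1 : IsCompactOperator (Wᗮ.orthogonalProjectionOnto : H →L[ℂ] Wᗮ) := by
        have : ProperSpace Wᗮ := FiniteDimensional.proper ℂ Wᗮ
        exact isCompactOperator_of_locallyCompactSpace_dom _
      exact h1.clm_comp (T ∘L Wᗮ.subtypeL)
    · refine ContinuousLinearMap.opNorm_le_bound _ hε.le fun x => ?_
      have h1 : (T ∘L Wᗮ.starProjection - T) x = -T (W.starProjection x) := by
        have h2 : x = W.starProjection x + Wᗮ.starProjection x :=
          (Submodule.starProjection_add_starProjection_orthogonal x).symm
        simp only [_root_.sub_apply, ContinuousLinearMap.comp_apply]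
        conv_lhs => rw [h2]
        simp
      rw [h1, norm_neg]
      refine (hcl _ (Submodule.starProjection_apply_mem _ _)).trans ?_
      gcongr
      exact Submodule.norm_starProjection_apply_le W x
  choose! S hS using happrox
  refine isCompactOperator_of_tendsto (F := fun n : ℕ => S (1 / (n + 1))) (l := atTop) ?_
    (Eventually.of_forall fun n => (hS _ (by positivity)).1)
  rw [tendsto_iff_norm_sub_tendsto_zero]
  exact squeeze_zero (fun _ => norm_nonneg _) (fun n => (hS _ (by positivity)).2)
    tendsto_one_div_add_atTop_nhds_zero_nat

end CompactOperator

/-! ### The resolvent -/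

section Construct

variable {E : Type*} {l : E → ℝ}

/-- The element of `L²(Γ)` given by a family of square integrable functions on the edges. -/
noncomputable def toL2 (u : E → ℝ → ℂ)
    (hu : ∀ e, MemLp (u e) 2 (volume.restrict (Set.Ioo 0 (l e)))) : L2 l :=
  WithLp.toLp 2 fun e => (hu e).toLp

theorem toL2_ae (u : E → ℝ → ℂ) (hu : ∀ e, MemLp (u e) 2 (volume.restrict (Set.Ioo 0 (l e))))
    (e : E) : toL2 u hu e =ᵐ[volume.restrict (Set.Ioo 0 (l e))] u e :=
  (hu e).coeFn_toLp

theorem L2_ext {ψ φ : L2 l} (h : ∀ e, ψ e =ᵐ[volume.restrict (Set.Ioo 0 (l e))] φ e) : ψ = φ :=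
  PiLp.ext fun e => Lp.ext (h e)

variable [Fintype E] [DecidableEq E] {P L : Matrix (E ⊕ E) (E ⊕ E) ℂ}

theorem exists_isRep {u du d2u : E → ℝ → ℂ} (h : ∀ e, IsH2 (l e) (u e) (du e) (d2u e))
    (hb : (P + L).mulVec (boundaryValues l u) + (1 - P).mulVec (inwardDerivatives l du) = 0) :
    ∃ p : laplacianGraph l P L, IsRep l P L p.1 u du d2u := by
  have hp : IsRep l P L (toL2 u fun e => memLp_two_of_continuousOn (h e).continuousOn,
      toL2 (-d2u) fun e => (h e).memLp.neg) u du d2u :=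
    ⟨h, toL2_ae _ _, toL2_ae _ _, hb⟩
  exact ⟨⟨_, mem_laplacianGraph.2 ⟨u, du, d2u, hp⟩⟩, hp⟩

end Construct

section HomogeneousSolution

variable {E : Type*}

/-- The solution of `u'' = σ² u` on every edge with `u_e(0) = w (inl e)` and
`u_e'(0) = σ w (inr e)`. -/
noncomputable def homSol (σ : ℝ) (w : E ⊕ E → ℂ) (e : E) (x : ℝ) : ℂ :=
  w (.inl e) * (Real.cosh (σ * x) : ℝ) + w (.inr e) * (Real.sinh (σ * x) : ℝ)

/-- The derivative of `homSol`. -/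
noncomputable def homSolDeriv (σ : ℝ) (w : E ⊕ E → ℂ) (e : E) (x : ℝ) : ℂ :=
  σ * (w (.inl e) * (Real.sinh (σ * x) : ℝ) + w (.inr e) * (Real.cosh (σ * x) : ℝ))

theorem isH2_homSol (a σ : ℝ) (w : E ⊕ E → ℂ) (e : E) :
    IsH2 a (homSol σ w e) (homSolDeriv σ w e) (fun x => (σ : ℂ) ^ 2 * homSol σ w e x) := by
  have hs : ∀ x : ℝ, HasDerivAt (fun x : ℝ => ((Real.sinh (σ * x) : ℝ) : ℂ))
      ((σ * Real.cosh (σ * x) : ℝ) : ℂ) x := fun x => by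
    have h1 : HasDerivAt (fun x : ℝ => Real.sinh (σ * x)) (Real.cosh (σ * x) * (σ * 1)) x :=
      ((hasDerivAt_id x).const_mul σ).sinh
    exact (h1.congr_deriv (by ring)).ofReal_comp
  have hc : ∀ x : ℝ, HasDerivAt (fun x : ℝ => ((Real.cosh (σ * x) : ℝ) : ℂ))
      ((σ * Real.sinh (σ * x) : ℝ) : ℂ) x := fun x => by
    have h1 : HasDerivAt (fun x : ℝ => Real.cosh (σ * x)) (Real.sinh (σ * x) * (σ * 1)) x :=
      ((hasDerivAt_id x).const_mul σ).cosh
    exact (h1.congr_deriv (by ring)).ofReal_comp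
  refine .of_hasDerivAt (fun x => ?_) (fun x => ?_) ?_
  · refine (((hc x).const_mul (w (.inl e))).add ((hs x).const_mul (w (.inr e)))).congr_deriv ?_
    simp only [homSolDeriv]; push_cast; ring
  · refine ((((hs x).const_mul (w (.inl e))).add
      ((hc x).const_mul (w (.inr e)))).const_mul (σ : ℂ)).congr_deriv ?_
    simp only [homSol]; push_cast; ring
  · unfold homSol; fun_prop

end HomogeneousSolution

section Resolvent

variable {E : Type*} [Fintype E] [DecidableEq E] {l : E → ℝ} {P L : Matrix (E ⊕ E) (E ⊕ E) ℂ}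

/-- The boundary condition, evaluated on the solutions of `u'' = σ² u`. -/
noncomputable def boundaryMap (l : E → ℝ) (P L : Matrix (E ⊕ E) (E ⊕ E) ℂ) (σ : ℝ) :
    (E ⊕ E → ℂ) →ₗ[ℂ] (E ⊕ E → ℂ) where
  toFun w := (P + L).mulVec (boundaryValues l (homSol σ w)) +
    (1 - P).mulVec (inwardDerivatives l (homSolDeriv σ w))
  map_add' w w' := by
    have h1 : boundaryValues l (homSol σ (w + w')) =
        boundaryValues l (homSol σ w) + boundaryValues l (homSol σ w') := by
      ext i; cases i <;> simp [boundaryValues, homSol] <;> ring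
    have h2 : inwardDerivatives l (homSolDeriv σ (w + w')) =
        inwardDerivatives l (homSolDeriv σ w) + inwardDerivatives l (homSolDeriv σ w') := by
      ext i; cases i <;> simp [inwardDerivatives, homSolDeriv] <;> ring
    rw [h1, h2, Matrix.mulVec_add, Matrix.mulVec_add, add_add_add_comm]
  map_smul' c w := by
    have h1 : boundaryValues l (homSol σ (c • w)) = c • boundaryValues l (homSol σ w) := by
      ext i; cases i <;> simp [boundaryValues, homSol] <;> ring
    have h2 : inwardDerivatives l (homSolDeriv σ (c • w)) =
        c • inwardDerivatives l (homSolDeriv σ w) := by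
      ext i; cases i <;> simp [inwardDerivatives, homSolDeriv] <;> ring
    rw [h1, h2, Matrix.mulVec_smul, Matrix.mulVec_smul, ← smul_add]
    rfl

theorem boundaryMap_injective (hl : ∀ e, 0 < l e) {σ : ℝ} (hσ : 0 < σ)
    (h0 : eigenspace l P L (-σ ^ 2) = ⊥) : Function.Injective (boundaryMap l P L σ) := by
  rw [← LinearMap.ker_eq_bot, LinearMap.ker_eq_bot']
  intro w hw
  obtain ⟨p, hp⟩ := exists_isRep (fun e => isH2_homSol (l e) σ w e) hw
  have hp2 : p.1.2 = ((-σ ^ 2 : ℝ) : ℂ) • p.1.1 := by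
    refine L2_ext fun e => ?_
    filter_upwards [hp.fst_ae e, hp.snd_ae e, Lp.coeFn_smul ((-σ ^ 2 : ℝ) : ℂ) (p.1.1 e)]
      with x h1 h2 h3
    rw [PiLp.smul_apply, h3, h2, Pi.smul_apply, h1]
    simp
  have hmem : p.1.1 ∈ eigenspace l P L (-σ ^ 2) := by
    rw [mem_eigenspace, ← hp2]; exact p.2
  rw [h0, Submodule.mem_bot] at hmem
  have hzero : ∀ e, Set.EqOn (homSol σ w e) 0 (Set.Icc 0 (l e)) := by
    intro e x hx
    have h1 := rep_eqOn hl p (hp.fst_ae e) (hp.isH2 e).continuousOn hx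
    have h2 : p.1.1 e =ᵐ[volume.restrict (Set.Ioo 0 (l e))] (0 : ℝ → ℂ) := by
      rw [hmem]; exact Lp.coeFn_zero _ _ _
    rw [← h1, rep_eqOn hl p h2 continuousOn_const hx]
  have hinl : ∀ e, w (.inl e) = 0 := fun e => by
    simpa [homSol] using hzero e ⟨le_rfl, (hl e).le⟩
  ext i
  rcases i with e | e
  · exact hinl e
  · have h := hzero e ⟨(hl e).le, le_rfl⟩
    have hs : ((Real.sinh (σ * l e) : ℝ) : ℂ) ≠ 0 := by
      exact_mod_cast (Real.sinh_pos_iff.2 (mul_pos hσ (hl e))).ne'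
    simp only [homSol, hinl, zero_mul, zero_add, Pi.zero_apply] at h
    exact (mul_eq_zero.1 h).resolve_right hs

/-- The map `ψ ↦ (-Δ + s) ψ` on the domain of `-Δ`, which is identified with the graph. -/
noncomputable def shifted (l : E → ℝ) (P L : Matrix (E ⊕ E) (E ⊕ E) ℂ) (s : ℝ) :
    laplacianGraph l P L →ₗ[ℂ] L2 l :=
  (LinearMap.snd ℂ _ _ + (s : ℂ) • LinearMap.fst ℂ _ _) ∘ₗ (laplacianGraph l P L).subtype

theorem shifted_apply (s : ℝ) (p : laplacianGraph l P L) :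
    shifted l P L s p = p.1.2 + (s : ℂ) • p.1.1 := rfl

theorem shifted_injective {s : ℝ} (h0 : eigenspace l P L (-s) = ⊥) :
    Function.Injective (shifted l P L s) := by
  rw [← LinearMap.ker_eq_bot, LinearMap.ker_eq_bot']
  intro p hp
  rw [shifted_apply] at hp
  have h2 : p.1.2 = ((-s : ℝ) : ℂ) • p.1.1 := by
    rw [eq_neg_of_add_eq_zero_left hp, Complex.ofReal_neg, neg_smul]
  have hmem : p.1.1 ∈ eigenspace l P L (-s) := by
    rw [mem_eigenspace, ← h2]; exact p.2
  rw [h0, Submodule.mem_bot] at hmem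
  rw [hmem, smul_zero] at h2
  exact Subtype.ext (Prod.ext hmem h2)

theorem shifted_surjective (hl : ∀ e, 0 < l e) {s : ℝ} (hs : 0 < s)
    (h0 : eigenspace l P L (-s) = ⊥) : Function.Surjective (shifted l P L s) := by
  intro φ
  set σ := √s with hσ
  have hσs : σ ^ 2 = s := Real.sq_sqrt hs.le
  have hsol := fun e => exists_isH2_solution (σ := σ) (Lp.memLp (φ e))
  choose v dv d2v hv hv2 using hsol
  have hsurj : Function.Surjective (boundaryMap l P L σ) :=
    LinearMap.injective_iff_surjective.1
      (boundaryMap_injective hl (Real.sqrt_pos.2 hs) (by rwa [hσs]))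
  obtain ⟨w, hw⟩ := hsurj
    (-((P + L).mulVec (boundaryValues l v) + (1 - P).mulVec (inwardDerivatives l dv)))
  have hb : (P + L).mulVec (boundaryValues l (v + homSol σ w)) +
      (1 - P).mulVec (inwardDerivatives l (dv + homSolDeriv σ w)) = 0 := by
    have h1 : boundaryValues l (v + homSol σ w) =
        boundaryValues l v + boundaryValues l (homSol σ w) := by
      ext i; cases i <;> simp [boundaryValues]
    have h2 : inwardDerivatives l (dv + homSolDeriv σ w) =
        inwardDerivatives l dv + inwardDerivatives l (homSolDeriv σ w) := by
      ext i; cases i <;> simp [inwardDerivatives, add_comm]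
    change (P + L).mulVec (boundaryValues l (homSol σ w)) +
      (1 - P).mulVec (inwardDerivatives l (homSolDeriv σ w)) = _ at hw
    rw [h1, h2, Matrix.mulVec_add, Matrix.mulVec_add, add_add_add_comm, hw, add_neg_cancel]
  obtain ⟨p, hp⟩ := exists_isRep (fun e => (hv e).add (isH2_homSol (l e) σ w e)) hb
  refine ⟨p, L2_ext fun e => ?_⟩
  rw [shifted_apply, PiLp.add_apply, PiLp.smul_apply]
  filter_upwards [hp.fst_ae e, hp.snd_ae e, hv2 e, Lp.coeFn_smul (s : ℂ) (p.1.1 e),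
    Lp.coeFn_add (p.1.2 e) ((s : ℂ) • p.1.1 e)] with x h1 h2 h3 h4 h5
  rw [h5, Pi.add_apply, h4, Pi.smul_apply, h1, h2]
  simp only [Pi.neg_apply, Pi.add_apply, h3, smul_eq_mul, ← hσs]
  push_cast
  ring

/-- The resolvent `(-Δ + s)⁻¹` as an everywhere defined linear map; `-s` must not be an
eigenvalue. -/
noncomputable def resolvent (hl : ∀ e, 0 < l e) {s : ℝ} (hs : 0 < s)
    (h0 : eigenspace l P L (-s) = ⊥) : L2 l →ₗ[ℂ] L2 l :=
  (LinearMap.fst ℂ _ _ ∘ₗ (laplacianGraph l P L).subtype) ∘ₗ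
    (LinearEquiv.ofBijective _ ⟨shifted_injective h0, shifted_surjective hl hs h0⟩).symm.toLinearMap

theorem resolvent_shifted (hl : ∀ e, 0 < l e) {s : ℝ} (hs : 0 < s)
    (h0 : eigenspace l P L (-s) = ⊥) (p : laplacianGraph l P L) :
    resolvent hl hs h0 (shifted l P L s p) = p.1.1 := by
  have h : (LinearEquiv.ofBijective (shifted l P L s)
      ⟨shifted_injective h0, shifted_surjective hl hs h0⟩).symm (shifted l P L s p) = p :=
    LinearEquiv.ofBijective_symm_apply_apply _ p
  exact congrArg (fun q : laplacianGraph l P L => q.1.1) h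

theorem resolvent_isSymmetric (hPL : IsBoundaryData P L) (hl : ∀ e, 0 < l e) {s : ℝ} (hs : 0 < s)
    (h0 : eigenspace l P L (-s) = ⊥) : (resolvent hl hs h0).IsSymmetric := by
  intro φ φ'
  obtain ⟨p, rfl⟩ := shifted_surjective hl hs h0 φ
  obtain ⟨q, rfl⟩ := shifted_surjective hl hs h0 φ'
  rw [resolvent_shifted, resolvent_shifted, shifted_apply, shifted_apply, inner_add_left,
    inner_add_right, inner_smul_left, inner_smul_right, inner_fst_snd_comm hPL hl p.2 q.2,
    Complex.conj_ofReal]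

theorem resolvent_isCompactOperator (hPL : IsBoundaryData P L) (hl : ∀ e, 0 < l e) {s : ℝ}
    (hs : 0 < s) (h0 : eigenspace l P L (-s) = ⊥) : IsCompactOperator (resolvent hl hs h0) := by
  -- Hellinger–Toeplitz
  have hcont := (resolvent_isSymmetric hPL hl hs h0).continuous
  refine isCompactOperator_of_small_on_finite_codim (T := ⟨resolvent hl hs h0, hcont⟩) ?_
  intro ε hε
  obtain ⟨R, hR⟩ := (Set.finite_range l).bddAbove
  obtain ⟨M, hM⟩ := exists_nat_gt (R ^ 2 / ε)
  have hMε : (R / (M + 1)) ^ 2 ≤ ε := by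
    rw [div_pow, div_le_iff₀ (by positivity)]
    rw [div_lt_iff₀ hε] at hM
    nlinarith [sq_nonneg (M : ℝ), (Nat.cast_nonneg M : (0 : ℝ) ≤ M)]
  let A : L2 l →ₗ[ℂ] (E × Fin (M + 2) → ℂ) := nodeEval hl M ∘ₗ
    (LinearEquiv.ofBijective _ ⟨shifted_injective h0, shifted_surjective hl hs h0⟩).symm.toLinearMap
  refine ⟨LinearMap.ker A, FiniteDimensional.of_injective _
    (LinearMap.ker_eq_bot.1 (Submodule.ker_liftQ_eq_bot _ A le_rfl le_rfl)), fun φ hφ => ?_⟩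
  obtain ⟨p, rfl⟩ := shifted_surjective hl hs h0 φ
  have hA : nodeEval hl M p = 0 := by
    have h : (LinearEquiv.ofBijective (shifted l P L s)
        ⟨shifted_injective h0, shifted_surjective hl hs h0⟩).symm (shifted l P L s p) = p :=
      LinearEquiv.ofBijective_symm_apply_apply _ p
    rw [← h]; exact hφ
  have h1 := norm_sq_le_of_nodeEval_eq_zero hPL hl (fun e => hR ⟨e, rfl⟩) M hA
  change ‖resolvent hl hs h0 (shifted l P L s p)‖ ≤ _
  rw [resolvent_shifted]
  set c := (R / ((M : ℝ) + 1)) ^ 2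
  have hc : 0 ≤ c := by positivity
  have h2 : (inner ℂ p.1.1 (shifted l P L s p)).re =
      (inner ℂ p.1.1 p.1.2).re + s * ‖p.1.1‖ ^ 2 := by
    rw [shifted_apply, inner_add_right, inner_smul_right, Complex.add_re, Complex.re_ofReal_mul,
      ← inner_self_eq_norm_sq (𝕜 := ℂ)]
    rfl
  have h3 : (inner ℂ p.1.1 (shifted l P L s p)).re ≤ ‖p.1.1‖ * ‖shifted l P L s p‖ :=
    re_inner_le_norm (𝕜 := ℂ) _ _
  have h4 : ‖p.1.1‖ ^ 2 ≤ c * (‖p.1.1‖ * ‖shifted l P L s p‖) := by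
    refine h1.trans (mul_le_mul_of_nonneg_left ?_ hc)
    nlinarith [sq_nonneg ‖p.1.1‖]
  rcases (norm_nonneg p.1.1).eq_or_lt with h | h
  · rw [← h]; positivity
  · have h5 : ‖p.1.1‖ ≤ c * ‖shifted l P L s p‖ := by
      refine le_of_mul_le_mul_left ?_ h
      calc ‖p.1.1‖ * ‖p.1.1‖ = ‖p.1.1‖ ^ 2 := by ring
        _ ≤ _ := h4
        _ = _ := by ring
    exact h5.trans (by gcongr)

/-- Eigenvectors of the resolvent with eigenvalue `r` are eigenfunctions of `-Δ` with eigenvalue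
`1 / r - s`. -/
theorem mem_eigenspace_of_resolvent (hl : ∀ e, 0 < l e) {s : ℝ} (hs : 0 < s)
    (h0 : eigenspace l P L (-s) = ⊥) {r : ℝ} (hr : r ≠ 0) {φ : L2 l}
    (hφ : resolvent hl hs h0 φ = (r : ℂ) • φ) : φ ∈ eigenspace l P L (1 / r - s) := by
  obtain ⟨p, rfl⟩ := shifted_surjective hl hs h0 φ
  rw [resolvent_shifted] at hφ
  have hr' : (r : ℂ) ≠ 0 := by exact_mod_cast hr
  have h1 : shifted l P L s p = (r : ℂ)⁻¹ • p.1.1 := by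
    rw [hφ, smul_smul, inv_mul_cancel₀ hr', one_smul]
  rw [h1]
  refine Submodule.smul_mem _ _ ?_
  rw [mem_eigenspace]
  have h2 : p.1.2 = ((1 / r - s : ℝ) : ℂ) • p.1.1 := by
    rw [shifted_apply] at h1
    rw [eq_sub_of_add_eq h1, ← sub_smul]
    congr 1; push_cast; rw [one_div]
  rw [← h2]
  exact p.2

end Resolvent

/-! ### The min-max principle -/

theorem norm_sq_eq_re_inner_self {H : Type*} [NormedAddCommGroup H] [InnerProductSpace ℂ H]
    (v : H) : ‖v‖ ^ 2 = (inner ℂ v v).re :=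
  (inner_self_eq_norm_sq (𝕜 := ℂ) v).symm

section MinMax

variable {E : Type*} [Fintype E] [DecidableEq E] {l : E → ℝ} {P L : Matrix (E ⊕ E) (E ⊕ E) ℂ}

/-- The resolvent is small on the orthogonal complement of the eigenfunctions with small
eigenvalue. By the spectral theorem the remaining eigenfunctions are dense there. -/
theorem norm_sq_resolvent_le (hPL : IsBoundaryData P L) (hl : ∀ e, 0 < l e) {s : ℝ}
    (hs : 0 < s) (hs' : ∀ κ, eigenspace l P L κ ≠ ⊥ → -s < κ) (h0 : eigenspace l P L (-s) = ⊥)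
    {x : ℝ} (hx : 0 < x + s) {φ : L2 l}
    (hφ : ∀ κ ≤ x, ∀ v ∈ eigenspace l P L κ, inner ℂ v φ = 0) :
    (x + s) * ‖resolvent hl hs h0 φ‖ ^ 2 ≤ (inner ℂ (resolvent hl hs h0 φ) φ).re := by
  set T := resolvent hl hs h0 with hT
  have hsymm : T.IsSymmetric := resolvent_isSymmetric hPL hl hs h0
  have hTc : Continuous T := hsymm.continuous
  let U : Submodule ℂ (L2 l) :=
    ⨆ r : {r : ℝ // r < 1 / (x + s)}, Module.End.eigenspace T ((r : ℝ) : ℂ)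
  have hUD : ∀ ξ ∈ U, (x + s) * ‖T ξ‖ ^ 2 ≤ (inner ℂ (T ξ) ξ).re := by
    intro ξ hξ
    obtain ⟨g, hg, rfl⟩ := (Submodule.mem_iSup_iff_exists_finsupp _ _).1 hξ
    have hort : ∀ i ∈ g.support, ∀ j ∈ g.support, i ≠ j → inner ℂ (g i) (g j) = 0 := by
      intro i _ j _ hij
      have h1 := hsymm (g i) (g j)
      rw [Module.End.mem_eigenspace_iff.1 (hg i), Module.End.mem_eigenspace_iff.1 (hg j),
        inner_smul_left, inner_smul_right, Complex.conj_ofReal] at h1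
      have h2 : (((i : ℝ) : ℂ) - (j : ℝ)) * inner ℂ (g i) (g j) = 0 := by
        rw [sub_mul, h1, sub_self]
      refine (mul_eq_zero.1 h2).resolve_left (sub_ne_zero.2 ?_)
      exact_mod_cast fun h => hij (Subtype.ext h)
    have e1 : g.sum (fun _ v => v) = ∑ i ∈ g.support, ((1 : ℝ) : ℂ) • g i := by
      simp [Finsupp.sum]
    have e2 : T (g.sum fun _ v => v) = ∑ i ∈ g.support, ((i : ℝ) : ℂ) • g i := by
      rw [Finsupp.sum, map_sum]
      exact Finset.sum_congr rfl fun i _ => Module.End.mem_eigenspace_iff.1 (hg i)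
    rw [norm_sq_eq_re_inner_self, e2, e1,
      inner_sum_smul_sum_smul _ hort (fun i => (i : ℝ)) (fun i => (i : ℝ)),
      inner_sum_smul_sum_smul _ hort (fun i => (i : ℝ)) (fun _ => 1), Complex.ofReal_re,
      Complex.ofReal_re, Finset.mul_sum]
    refine Finset.sum_le_sum fun i hi => ?_
    have hi0 : 0 ≤ (i : ℝ) := by
      by_contra hneg
      push Not at hneg
      have h1 := mem_eigenspace_of_resolvent hl hs h0 hneg.ne
        (Module.End.mem_eigenspace_iff.1 (hg i))
      have h2 := hs' _ ((Submodule.ne_bot_iff _).2 ⟨_, h1, Finsupp.mem_support_iff.1 hi⟩)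
      have h3 : 1 / (i : ℝ) < 0 := one_div_neg.2 hneg
      linarith
    have hi1 : (x + s) * (i : ℝ) ≤ 1 := by
      have h := i.2.le
      rw [le_div_iff₀ hx] at h
      linarith
    have h3 : 0 ≤ (i : ℝ) * ‖g i‖ ^ 2 := by positivity
    nlinarith
  have hclosed : IsClosed {ξ : L2 l | (x + s) * ‖T ξ‖ ^ 2 ≤ (inner ℂ (T ξ) ξ).re} :=
    isClosed_le (by fun_prop) (Complex.continuous_re.comp (hTc.inner continuous_id))
  suffices hmem : φ ∈ U.topologicalClosure from closure_minimal hUD hclosed hmem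
  set Y := U.topologicalClosure with hY
  have : CompleteSpace Y := U.isClosed_topologicalClosure.completeSpace_coe
  have hdecomp := Submodule.starProjection_add_starProjection_orthogonal (K := Y) φ
  have hzero : Yᗮ.starProjection φ = 0 := by
    have hbot := ContinuousLinearMap.orthogonalComplement_iSup_eigenspaces_eq_bot
      (T := ⟨T, hTc⟩) (resolvent_isCompactOperator hPL hl hs h0) hsymm
    rw [← Submodule.mem_bot ℂ, ← hbot, Submodule.mem_orthogonal]
    intro v hv
    induction hv using Submodule.iSup_induction' with
    | zero => exact inner_zero_left _
    | add a b _ _ ha hb => rw [inner_add_left, ha, hb, add_zero]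
    | mem μ v hv =>
      rcases eq_or_ne v 0 with rfl | hv0
      · exact inner_zero_left _
      have hev : Module.End.HasEigenvalue T μ :=
        Module.End.hasEigenvalue_of_hasEigenvector ⟨hv, hv0⟩
      have hμ : ((μ.re : ℝ) : ℂ) = μ := Complex.conj_eq_iff_re.1 (hsymm.conj_eigenvalue_eq_self hev)
      set r := μ.re
      have hv' : v ∈ Module.End.eigenspace T (r : ℂ) := by rw [hμ]; exact hv
      by_cases hr : r < 1 / (x + s)
      · have hvY : v ∈ Y := U.le_topologicalClosure
          (Submodule.mem_iSup_of_mem (⟨r, hr⟩ : {r : ℝ // r < 1 / (x + s)}) hv')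
        exact (Submodule.mem_orthogonal _ _).1 (Submodule.starProjection_apply_mem Yᗮ φ) v hvY
      · push Not at hr
        have hr0 : 0 < r := (by positivity : 0 < 1 / (x + s)).trans_le hr
        have hvφ : inner ℂ v φ = 0 := by
          refine hφ _ ?_ v (mem_eigenspace_of_resolvent hl hs h0 hr0.ne'
            (Module.End.mem_eigenspace_iff.1 hv'))
          have := (one_div_le hx hr0).1 hr
          linarith
        have hvU : v ∈ Uᗮ := by
          rw [Submodule.mem_orthogonal]
          intro w hw
          induction hw using Submodule.iSup_induction' with
          | zero => exact inner_zero_left _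
          | add a b _ _ ha hb => rw [inner_add_left, ha, hb, add_zero]
          | mem i w hw =>
            have h1 := hsymm w v
            rw [Module.End.mem_eigenspace_iff.1 hw, Module.End.mem_eigenspace_iff.1 hv',
              inner_smul_left, inner_smul_right, Complex.conj_ofReal] at h1
            have h2 : (((i : ℝ) : ℂ) - r) * inner ℂ w v = 0 := by rw [sub_mul, h1, sub_self]
            refine (mul_eq_zero.1 h2).resolve_left (sub_ne_zero.2 ?_)
            exact_mod_cast (i.2.trans_le hr).ne
        have hvY : v ∈ Yᗮ := by rwa [hY, Submodule.orthogonal_closure]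
        have h2 : inner ℂ v (Y.starProjection φ) = 0 :=
          Submodule.inner_left_of_mem_orthogonal (Submodule.starProjection_apply_mem Y φ) hvY
        rw [← hdecomp, inner_add_right, h2, zero_add] at hvφ
        exact hvφ
  rw [← hdecomp, hzero, add_zero]
  exact Submodule.starProjection_apply_mem Y φ

/-- The upper bound of the min-max principle, for a family of trial functions that is orthogonal
both in `L²` and for the quadratic form. -/
theorem exists_linearIndependent_eigenfunctions [Nonempty E] (hPL : IsBoundaryData P L)
    (hl : ∀ e, 0 < l e) {n : ℕ} {x y : ℝ} (hxy : x < y) (p : Fin n → laplacianGraph l P L)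
    (hp0 : ∀ i, (p i).1.1 ≠ 0) (hp1 : ∀ i j, i ≠ j → inner ℂ (p i).1.1 (p j).1.1 = 0)
    (hp2 : ∀ i j, i ≠ j → inner ℂ (p i).1.1 (p j).1.2 = 0)
    (hp : ∀ i, (inner ℂ (p i).1.1 (p i).1.2).re ≤ x * ‖(p i).1.1‖ ^ 2) :
    ∃ f : Fin n → L2 l, LinearIndependent ℂ f ∧
      ∀ i, ∃ κ ≤ y, f i ∈ eigenspace l P L κ := by
  -- if a basis `b` of the span of the eigenfunctions has fewer than `n` elements, then some
  -- combination `q` of the trial functions is orthogonal to all eigenfunctions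
  obtain ⟨b, hbS, hspan, hli⟩ := exists_linearIndependent ℂ
    {f : L2 l | ∃ κ ≤ y, f ∈ eigenspace l P L κ}
  by_cases hcard : ∃ g : Fin n → b, Function.Injective g
  · obtain ⟨g, hg⟩ := hcard
    exact ⟨fun i => g i, hli.comp g hg, fun i => hbS (g i).2⟩
  exfalso
  have hfin : Finite b := by
    by_contra hinf
    have : Infinite b := not_finite_iff_infinite.1 hinf
    exact hcard ⟨fun i => Infinite.natEmbedding b i,
      (Infinite.natEmbedding b).injective.comp Fin.val_injective⟩
  have := Fintype.ofFinite b
  have hlt : Fintype.card b < n := by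
    by_contra h
    push Not at h
    obtain ⟨g⟩ := Function.Embedding.nonempty_of_card_le (α := Fin n) (β := b) (by simpa using h)
    exact hcard ⟨g, g.injective⟩
  let comb : (Fin n → ℂ) →ₗ[ℂ] laplacianGraph l P L := Fintype.linearCombination ℂ p
  let A : (Fin n → ℂ) →ₗ[ℂ] (b → ℂ) := LinearMap.pi fun v =>
    (innerₛₗ ℂ (v : L2 l)) ∘ₗ (LinearMap.fst ℂ _ _ ∘ₗ (laplacianGraph l P L).subtype) ∘ₗ comb
  have hker : LinearMap.ker A ≠ ⊥ := by
    refine LinearMap.ker_ne_bot_of_finrank_lt ?_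
    simpa using hlt
  obtain ⟨c, hc, hc0⟩ := (Submodule.ne_bot_iff _).1 hker
  set q := comb c with hq
  have e1 : q.1.1 = ∑ i, c i • (p i).1.1 := by
    simp [hq, comb, Fintype.linearCombination_apply, Prod.fst_sum]
  have e2 : q.1.2 = ∑ i, c i • (p i).1.2 := by
    simp [hq, comb, Fintype.linearCombination_apply, Prod.snd_sum]
  have hq0 : q.1.1 ≠ 0 := by
    rw [e1]
    intro h
    exact hc0 (funext (Fintype.linearIndependent_iff.1
      (linearIndependent_of_ne_zero_of_inner_eq_zero hp0 fun i j => hp1 i j) c h))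
  have hqle : (inner ℂ q.1.1 q.1.2).re ≤ x * ‖q.1.1‖ ^ 2 := by
    have h1 : ∀ w : Fin n → L2 l, (∀ i j, i ≠ j → inner ℂ (p i).1.1 (w j) = 0) →
        (inner ℂ q.1.1 (∑ i, c i • w i)).re = ∑ i, ‖c i‖ ^ 2 * (inner ℂ (p i).1.1 (w i)).re := by
      intro w hw
      rw [e1, sum_inner, Complex.re_sum]
      refine Finset.sum_congr rfl fun i _ => ?_
      rw [inner_sum, Finset.sum_eq_single i]
      · rw [inner_smul_left, inner_smul_right, ← mul_assoc, mul_comm _ (c i), Complex.mul_conj,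
          Complex.normSq_eq_norm_sq, Complex.re_ofReal_mul]
      · intro j _ hij
        rw [inner_smul_left, inner_smul_right, hw i j hij.symm, mul_zero, mul_zero]
      · exact fun h => absurd (Finset.mem_univ i) h
    have h2 : ‖q.1.1‖ ^ 2 = ∑ i, ‖c i‖ ^ 2 * ‖(p i).1.1‖ ^ 2 := by
      rw [norm_sq_eq_re_inner_self]
      conv_lhs => enter [1]; arg 3; rw [e1]
      rw [h1 _ hp1]
      exact Finset.sum_congr rfl fun i _ => by rw [norm_sq_eq_re_inner_self (p i).1.1]
    rw [h2, e2, h1 _ hp2, Finset.mul_sum]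
    refine Finset.sum_le_sum fun i _ => ?_
    calc ‖c i‖ ^ 2 * (inner ℂ (p i).1.1 (p i).1.2).re
        ≤ ‖c i‖ ^ 2 * (x * ‖(p i).1.1‖ ^ 2) := by gcongr; exact hp i
      _ = _ := by ring
  have hort : ∀ v ∈ Submodule.span ℂ b, inner ℂ v q.1.1 = 0 := by
    intro v hv
    induction hv using Submodule.span_induction with
    | mem w hw => exact congrFun hc ⟨w, hw⟩
    | zero => exact inner_zero_left _
    | add a b _ _ ha hb => rw [inner_add_left, ha, hb, add_zero]
    | smul a w _ hw => rw [inner_smul_left, hw, mul_zero]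
  obtain ⟨s', hs'0, hs'⟩ := exists_lt_eigenvalues (P := P) (L := L) hPL hl
  set s := s' + |y| + 1 with hs_def
  have hs : 0 < s := by positivity
  have hsy : 0 < y + s := by linarith [neg_abs_le y]
  have hslt : ∀ κ, eigenspace l P L κ ≠ ⊥ → -s < κ := fun κ hκ => by
    linarith [hs' κ hκ, abs_nonneg y]
  have h0 : eigenspace l P L (-s) = ⊥ := by
    by_contra h
    exact (hslt _ h).false
  have hmain := norm_sq_resolvent_le hPL hl hs hslt h0 hsy (φ := shifted l P L s q) (by
    intro κ hκ v hv
    have h1 : inner ℂ v q.1.1 = 0 := hort v (by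
      rw [hspan]; exact Submodule.subset_span ⟨κ, hκ, hv⟩)
    have h2 : inner ℂ v q.1.2 = 0 := by
      have h3 := inner_fst_snd_comm hPL hl (mem_eigenspace.1 hv) q.2
      rw [h3, inner_smul_left, h1, mul_zero]
    rw [shifted_apply, inner_add_right, inner_smul_right, h1, h2, mul_zero, add_zero])
  rw [resolvent_shifted, shifted_apply, inner_add_right, inner_smul_right, Complex.add_re,
    Complex.re_ofReal_mul, ← norm_sq_eq_re_inner_self] at hmain
  have hpos : 0 < ‖q.1.1‖ ^ 2 := by positivity
  nlinarith

end MinMax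

/-! ### Trial functions supported in one edge -/

section Eigenvalue

variable {E : Type*} [Fintype E] [DecidableEq E] {l : E → ℝ} {P L : Matrix (E ⊕ E) (E ⊕ E) ℂ}

/-- The upper bounds for the eigenvalues of `n + 1` linearly independent eigenfunctions; the `n`-th
eigenvalue is their infimum. -/
def eigenvalueBounds (l : E → ℝ) (P L : Matrix (E ⊕ E) (E ⊕ E) ℂ) (n : ℕ) : Set ℝ :=
  {x : ℝ | ∃ f : Fin (n + 1) → L2 l, LinearIndependent ℂ f ∧
    ∀ i, ∃ κ ≤ x, f i ∈ eigenspace l P L κ}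

theorem exists_eigenspace_ne_bot {n : ℕ} {x : ℝ} (hx : x ∈ eigenvalueBounds l P L n) :
    ∃ κ ≤ x, eigenspace l P L κ ≠ ⊥ := by
  obtain ⟨f, hf, h⟩ := hx
  obtain ⟨κ, hκ, hm⟩ := h 0
  exact ⟨κ, hκ, (Submodule.ne_bot_iff _).2 ⟨_, hm, hf.ne_zero 0⟩⟩

theorem bddBelow_eigenvalueBounds [Nonempty E] (hPL : IsBoundaryData P L) (hl : ∀ e, 0 < l e)
    (n : ℕ) : BddBelow (eigenvalueBounds l P L n) := by
  obtain ⟨s, -, hs⟩ := exists_lt_eigenvalues (P := P) (L := L) hPL hl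
  refine ⟨-s, fun x hx => ?_⟩
  obtain ⟨κ, hκ, hm⟩ := exists_eigenspace_ne_bot hx
  exact (hs κ hm).le.trans hκ

/-- `p` is a family of `n` nonzero trial functions for `-Δ`, orthogonal both in `L²` and for the
quadratic form, with Rayleigh quotients at most `x`. -/
structure IsTrialFamily {n : ℕ} (p : Fin n → laplacianGraph l P L) (x : ℝ) : Prop where
  ne_zero : ∀ i, (p i).1.1 ≠ 0
  inner_eq_zero : ∀ i j, i ≠ j → inner ℂ (p i).1.1 (p j).1.1 = 0
  form_eq_zero : ∀ i j, i ≠ j → inner ℂ (p i).1.1 (p j).1.2 = 0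
  form_le : ∀ i, (inner ℂ (p i).1.1 (p i).1.2).re ≤ x * ‖(p i).1.1‖ ^ 2

theorem IsTrialFamily.mem_eigenvalueBounds [Nonempty E] (hPL : IsBoundaryData P L)
    (hl : ∀ e, 0 < l e) {n : ℕ} {x y : ℝ} {p : Fin (n + 1) → laplacianGraph l P L}
    (hp : IsTrialFamily p x) (hxy : x < y) : y ∈ eigenvalueBounds l P L n :=
  exists_linearIndependent_eigenfunctions hPL hl hxy p hp.1 hp.2 hp.3 hp.4

theorem IsTrialFamily.eigenvalue_le [Nonempty E] (hPL : IsBoundaryData P L)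
    (hl : ∀ e, 0 < l e) {n : ℕ} {x : ℝ} {p : Fin (n + 1) → laplacianGraph l P L}
    (hp : IsTrialFamily p x) : eigenvalue l P L n ≤ x :=
  le_of_forall_gt_imp_ge_of_dense fun _ hy =>
    csInf_le (bddBelow_eigenvalueBounds hPL hl n) (hp.mem_eigenvalueBounds hPL hl hy)

end Eigenvalue

section Bumps

/-- Smooth functions with disjoint supports inside an interval. -/
theorem exists_disjoint_bumps {a : ℝ} (ha : 0 < a) (n : ℕ) :
    ∃ f : Fin (n + 1) → ℝ → ℝ, (∀ i, ContDiff ℝ 2 (f i)) ∧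
      (∀ i, ∀ x ∉ Set.Ioo 0 a, x ∉ tsupport (f i)) ∧
      (∀ i j, i ≠ j → ∀ x, x ∉ tsupport (f i) ∨ x ∉ tsupport (f j)) ∧
      ∀ i, ∃ x ∈ Set.Icc 0 a, f i x ≠ 0 := by
  set h := a / (n + 2) with hh
  have hpos : 0 < h := by positivity
  have ha' : a = h * (n + 2) := by rw [hh]; field_simp
  let c : Fin (n + 1) → ℝ := fun i => ((i : ℕ) + 1) * h
  let b : ∀ i, ContDiffBump (c i) := fun i =>
    { rIn := h / 4, rOut := h / 3, rIn_pos := by positivity, rIn_lt_rOut := by linarith }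
  have ht : ∀ i x, x ∈ tsupport (b i) → |x - c i| ≤ h / 3 := by
    intro i x hx
    rw [(b i).tsupport_eq, Metric.mem_closedBall, Real.dist_eq] at hx
    exact hx
  have hc : ∀ i, h ≤ c i ∧ c i + h ≤ a := by
    intro i
    have h1 : ((i : ℕ) : ℝ) + 1 ≤ n + 1 := by exact_mod_cast i.2
    have h2 : (0 : ℝ) ≤ (i : ℕ) := by positivity
    constructor
    · simp only [c]; nlinarith
    · simp only [c]; rw [ha']; nlinarith
  refine ⟨fun i => b i, fun i => (b i).contDiff, fun i x hx hxt => hx ?_, fun i j hij x => ?_,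
    fun i => ⟨c i, ?_, ?_⟩⟩
  · have h1 := abs_le.1 (ht i x hxt)
    have h2 := hc i
    exact ⟨by linarith, by linarith⟩
  · by_contra hcon
    push Not at hcon
    have h1 := abs_le.1 (ht i x hcon.1)
    have h2 := abs_le.1 (ht j x hcon.2)
    have h3 : ∀ i j : Fin (n + 1), i < j → c i + h ≤ c j := by
      intro i j hlt
      have : ((i : ℕ) : ℝ) + 1 ≤ (j : ℕ) := by exact_mod_cast hlt
      simp only [c]; nlinarith
    rcases lt_or_gt_of_ne hij with h | h
    · linarith [h3 _ _ h]
    · linarith [h3 _ _ h]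
  · have := hc i
    exact ⟨by linarith, by linarith⟩
  · exact ((b i).pos_of_mem_ball (Metric.mem_ball_self (b i).rOut_pos)).ne'

variable {E : Type*} [Fintype E] [DecidableEq E] [Nonempty E] {P L : Matrix (E ⊕ E) (E ⊕ E) ℂ}

/-- Bumps on one edge, stretched along with the graph, have Rayleigh quotients of order `η⁻²`. -/
theorem exists_isTrialFamily {l : E → ℝ} (hl : ∀ e, 0 < l e) (n : ℕ) :
    ∃ C : ℝ, ∀ η : ℝ, 0 < η → ∃ p : Fin (n + 1) → laplacianGraph (fun e => η * l e) P L,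
      IsTrialFamily p (C / η ^ 2) := by
  obtain ⟨e₀⟩ := ‹Nonempty E›
  set a := l e₀ with ha_def
  have ha : 0 < a := hl e₀
  obtain ⟨f, hf, hfa, hdisj, hne⟩ := exists_disjoint_bumps ha n
  have hd1 : ∀ i x, HasDerivAt (f i) (deriv (f i) x) x := fun i x =>
    ((hf i).differentiable (by norm_num) x).hasDerivAt
  have hf' : ∀ i, ContDiff ℝ 1 (deriv (f i)) := fun i =>
    ContDiff.deriv' (n := 1) (by rw [one_add_one_eq_two]; exact hf i)
  have hd2 : ∀ i x, HasDerivAt (deriv (f i)) (deriv (deriv (f i)) x) x := fun i x =>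
    ((hf' i).differentiable (by norm_num) x).hasDerivAt
  have hc0 : ∀ i, Continuous (f i) := fun i => (hf i).continuous
  have hc2 : ∀ i, Continuous (deriv (deriv (f i))) := fun i =>
    (hf' i).continuous_deriv (by norm_num)
  have hz0 : ∀ i x, x ∉ tsupport (f i) → f i x = 0 :=
    fun i x hx => image_eq_zero_of_notMem_tsupport hx
  have hz1 : ∀ i x, x ∉ tsupport (f i) → deriv (f i) x = 0 := fun i x hx => by
    by_contra h
    exact hx (support_deriv_subset h)
  have hz2 : ∀ i x, x ∉ tsupport (f i) → deriv (deriv (f i)) x = 0 := fun i x hx => by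
    by_contra h
    have h1 : tsupport (deriv (f i)) ⊆ tsupport (f i) :=
      closure_minimal support_deriv_subset (isClosed_tsupport _)
    exact hx (h1 (support_deriv_subset h))
  let N : Fin (n + 1) → ℝ := fun i => ∫ x in (0 : ℝ)..a, f i x ^ 2
  let D : Fin (n + 1) → ℝ := fun i => ∫ x in (0 : ℝ)..a, f i x * -deriv (deriv (f i)) x
  have hN : ∀ i, 0 < N i := by
    intro i
    obtain ⟨x, hx, hfx⟩ := hne i
    exact intervalIntegral.integral_pos ha ((hc0 i).pow 2).continuousOn
      (fun y _ => by positivity) ⟨x, hx, by positivity⟩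
  refine ⟨∑ i, |D i / N i|, fun η hη => ?_⟩
  have hl' : ∀ e, 0 < η * l e := fun e => mul_pos hη (hl e)
  let u : Fin (n + 1) → E → ℝ → ℂ := fun i =>
    Pi.single e₀ fun x => ((f i (x / η) : ℝ) : ℂ)
  let du : Fin (n + 1) → E → ℝ → ℂ := fun i =>
    Pi.single e₀ fun x => ((deriv (f i) (x / η) / η : ℝ) : ℂ)
  let d2u : Fin (n + 1) → E → ℝ → ℂ := fun i =>
    Pi.single e₀ fun x => ((deriv (deriv (f i)) (x / η) / η ^ 2 : ℝ) : ℂ)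
  have hH2 : ∀ i e, IsH2 (η * l e) (u i e) (du i e) (d2u i e) := by
    intro i e
    rcases eq_or_ne e e₀ with rfl | he
    · simp only [u, du, d2u, Pi.single_eq_same]
      refine .of_hasDerivAt (fun x => HasDerivAt.ofReal_comp ?_)
        (fun x => HasDerivAt.ofReal_comp ?_) ?_
      · have h1 := (hd1 i (x / η)).comp x ((hasDerivAt_id x).div_const η)
        exact h1.congr_deriv (by simp; ring)
      · have h1 := ((hd2 i (x / η)).comp x ((hasDerivAt_id x).div_const η)).div_const η
        exact h1.congr_deriv (by simp; ring)
      · have := hc2 i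
        fun_prop
    · simp only [u, du, d2u, Pi.single_eq_of_ne he]
      exact IsH2.zero _
  have hb : ∀ i, (P + L).mulVec (boundaryValues (fun e => η * l e) (u i)) +
      (1 - P).mulVec (inwardDerivatives (fun e => η * l e) (du i)) = 0 := by
    intro i
    have hout : ∀ x, x = 0 ∨ x = a → x ∉ tsupport (f i) := fun x hx =>
      hfa i x (by rintro ⟨h1, h2⟩; rcases hx with rfl | rfl <;> linarith)
    have h1 : boundaryValues (fun e => η * l e) (u i) = 0 := by
      ext k
      rcases k with e | e <;> rcases eq_or_ne e e₀ with rfl | he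
      · simp [boundaryValues, u, hz0 i 0 (hout 0 (.inl rfl))]
      · simp [boundaryValues, u, Pi.single_eq_of_ne he]
      · simp [boundaryValues, u, mul_div_cancel_left₀ _ hη.ne', hz0 i a (hout a (.inr rfl)),
          ← ha_def]
      · simp [boundaryValues, u, Pi.single_eq_of_ne he]
    have h2 : inwardDerivatives (fun e => η * l e) (du i) = 0 := by
      ext k
      rcases k with e | e <;> rcases eq_or_ne e e₀ with rfl | he
      · simp [inwardDerivatives, du, hz1 i 0 (hout 0 (.inl rfl))]
      · simp [inwardDerivatives, du, Pi.single_eq_of_ne he]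
      · simp [inwardDerivatives, du, mul_div_cancel_left₀ _ hη.ne', hz1 i a (hout a (.inr rfl)),
          ← ha_def]
      · simp [inwardDerivatives, du, Pi.single_eq_of_ne he]
    rw [h1, h2, Matrix.mulVec_zero, Matrix.mulVec_zero, add_zero]
  choose p hp using fun i => exists_isRep (hH2 i) (hb i)
  have hnorm : ∀ i, ‖(p i).1.1‖ ^ 2 = η * N i := by
    intro i
    rw [inner_self_eq_sum hl' (hp i).fst_ae, Finset.sum_eq_single e₀]
    · simp only [u, Pi.single_eq_same, Complex.norm_real, Real.norm_eq_abs, sq_abs]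
      rw [intervalIntegral.integral_comp_div (fun x => f i x ^ 2) hη.ne', zero_div,
        mul_div_cancel_left₀ _ hη.ne', smul_eq_mul]
    · intro e _ he
      simp [u, Pi.single_eq_of_ne he]
    · exact fun h => absurd (Finset.mem_univ _) h
  have hform : ∀ i, (inner ℂ (p i).1.1 (p i).1.2).re = D i / η := by
    intro i
    rw [inner_eq_sum_integral hl' (hp i).fst_ae (hp i).snd_ae, Finset.sum_eq_single e₀]
    · have h1 : ∀ x : ℝ, star (u i e₀ x) * (-d2u i e₀) x =
          ((f i (x / η) * -deriv (deriv (f i)) (x / η) / η ^ 2 : ℝ) : ℂ) := by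
        intro x
        simp only [u, d2u, Pi.single_eq_same, Pi.neg_apply, Complex.star_def, Complex.conj_ofReal]
        push_cast; ring
      simp only [h1]
      rw [intervalIntegral.integral_ofReal, Complex.ofReal_re, intervalIntegral.integral_div,
        intervalIntegral.integral_comp_div (fun x => f i x * -deriv (deriv (f i)) x) hη.ne',
        zero_div, mul_div_cancel_left₀ _ hη.ne', smul_eq_mul]
      change η * D i / η ^ 2 = D i / η
      field_simp
    · intro e _ he
      simp [u, Pi.single_eq_of_ne he]
    · exact fun h => absurd (Finset.mem_univ _) h
  have hzero : ∀ i j, i ≠ j → ∀ (g : ℝ → ℝ), (∀ x, x ∉ tsupport (f j) → g x = 0) →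
      ∀ x, star (u i e₀ x) * ((g (x / η) : ℝ) : ℂ) = 0 := by
    intro i j hij g hg x
    simp only [u, Pi.single_eq_same]
    rcases hdisj i j hij (x / η) with h | h
    · simp [hz0 i _ h]
    · simp [hg _ h]
  refine ⟨p, fun i h => ?_, fun i j hij => ?_, fun i j hij => ?_, fun i => ?_⟩
  · have h1 := hnorm i
    rw [h, norm_zero] at h1
    have := mul_pos hη (hN i)
    norm_num at h1
    rcases h1 with h1 | h1
    · exact hη.ne' h1
    · exact (hN i).ne' h1
  · rw [inner_eq_sum_integral hl' (hp i).fst_ae (hp j).fst_ae]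
    refine Finset.sum_eq_zero fun e _ => ?_
    rcases eq_or_ne e e₀ with rfl | he
    · have h1 := hzero i j hij (f j) (hz0 j)
      have h2 : ∀ x, star (u i e x) * u j e x = 0 := fun x => by
        rw [← h1 x]; simp only [u, Pi.single_eq_same]
      simp only [h2, intervalIntegral.integral_zero]
    · simp [u, Pi.single_eq_of_ne he]
  · rw [inner_eq_sum_integral hl' (hp i).fst_ae (hp j).snd_ae]
    refine Finset.sum_eq_zero fun e _ => ?_
    rcases eq_or_ne e e₀ with rfl | he
    · have h1 := hzero i j hij (fun x => -(deriv (deriv (f j)) x / η ^ 2))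
        (fun x hx => by rw [hz2 j x hx]; simp)
      have h2 : ∀ x, star (u i e x) * (-d2u j e) x = 0 := fun x => by
        rw [← h1 x]; simp only [u, d2u, Pi.single_eq_same, Pi.neg_apply]; push_cast; rfl
      simp only [h2, intervalIntegral.integral_zero]
    · simp [u, Pi.single_eq_of_ne he]
  · rw [hform, hnorm]
    have h1 : D i / N i ≤ ∑ i, |D i / N i| := (le_abs_self _).trans
      (Finset.single_le_sum (f := fun i => |D i / N i|) (fun _ _ => abs_nonneg _)
        (Finset.mem_univ i))
    rw [div_le_iff₀ (hN i)] at h1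
    calc D i / η ≤ ((∑ i, |D i / N i|) * N i) / η := by gcongr
      _ = _ := by field_simp

end Bumps

/-! ### The bound state and bounds for eigenvalues -/

section BoundState

theorem hasDerivAt_posPart_sq (y : ℝ) : HasDerivAt (fun y : ℝ => max y 0 ^ 2) (2 * max y 0) y := by
  rcases lt_trichotomy y 0 with h | rfl | h
  · rw [max_eq_right h.le, mul_zero]
    refine (hasDerivAt_const y (0 : ℝ)).congr_of_eventuallyEq ?_
    filter_upwards [Iio_mem_nhds h] with z hz
    rw [max_eq_right (le_of_lt hz)]; norm_num
  · have h1 : (fun y : ℝ => max y 0 ^ 2) =O[nhds 0] fun x : ℝ => ‖x - 0‖ ^ 2 := by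
      refine Asymptotics.IsBigO.of_bound 1 (Eventually.of_forall fun x => ?_)
      rw [sub_zero, one_mul, norm_pow, norm_pow, norm_norm, Real.norm_eq_abs, Real.norm_eq_abs]
      refine pow_le_pow_left₀ (abs_nonneg _) ?_ 2
      rw [abs_of_nonneg (le_max_right _ _)]
      exact max_le (le_abs_self x) (abs_nonneg x)
    have h2 := (h1.hasFDerivAt (by norm_num : 1 < 2)).hasDerivAt
    simpa using h2
  · rw [max_eq_left h.le]
    refine (((hasDerivAt_id y).pow 2).congr_deriv (by simp)).congr_of_eventuallyEq ?_
    filter_upwards [Ioi_mem_nhds h] with z hz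
    simp [max_eq_left (le_of_lt (Set.mem_Ioi.1 hz))]

/-- A profile with `χ(0) = 1`, `χ'(0) = -c` and support of length `2 / c`. -/
noncomputable def profile (c x : ℝ) : ℝ := max (1 - c * x / 2) 0 ^ 2

/-- The derivative of `profile c`. -/
noncomputable def profileDeriv (c x : ℝ) : ℝ := -c * max (1 - c * x / 2) 0

/-- The second derivative of `profile c`, away from the point `2 / c`. -/
noncomputable def profileDeriv2 (c x : ℝ) : ℝ := if c * x < 2 then c ^ 2 / 2 else 0

theorem hasDerivAt_profile (c x : ℝ) : HasDerivAt (profile c) (profileDeriv c x) x := by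
  have h1 : HasDerivAt (fun x : ℝ => 1 - c * x / 2) (-(c / 2)) x := by
    have := (((hasDerivAt_id x).const_mul c).div_const 2).const_sub 1
    exact this.congr_deriv (by ring)
  have h2 := (hasDerivAt_posPart_sq (1 - c * x / 2)).comp x h1
  exact h2.congr_deriv (by unfold profileDeriv; ring)

theorem hasDerivAt_profileDeriv {c x : ℝ} (hx : c * x ≠ 2) :
    HasDerivAt (profileDeriv c) (profileDeriv2 c x) x := by
  rcases lt_or_gt_of_ne hx with h | h
  · have h1 : HasDerivAt (fun x : ℝ => -c * (1 - c * x / 2)) (c ^ 2 / 2) x := by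
      have := ((((hasDerivAt_id x).const_mul c).div_const 2).const_sub 1).const_mul (-c)
      exact this.congr_deriv (by simp; ring)
    rw [profileDeriv2, if_pos h]
    refine h1.congr_of_eventuallyEq ?_
    have hnear : ∀ᶠ z in nhds x, c * z < 2 :=
      (by fun_prop : Continuous fun z : ℝ => c * z).continuousAt.eventually_lt_const h
    filter_upwards [hnear] with z hz
    rw [profileDeriv, max_eq_left (by linarith)]
  · rw [profileDeriv2, if_neg h.le.not_gt]
    refine (hasDerivAt_const x (0 : ℝ)).congr_of_eventuallyEq ?_
    have hnear : ∀ᶠ z in nhds x, 2 < c * z :=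
      (by fun_prop : Continuous fun z : ℝ => c * z).continuousAt.eventually_const_lt h
    filter_upwards [hnear] with z hz
    rw [profileDeriv, max_eq_right (by linarith), mul_zero]

theorem profile_eq_zero {c x : ℝ} (h : 2 ≤ c * x) : profile c x = 0 := by
  rw [profile, max_eq_right (by linarith)]; norm_num

theorem profileDeriv_eq_zero {c x : ℝ} (h : 2 ≤ c * x) : profileDeriv c x = 0 := by
  rw [profileDeriv, max_eq_right (by linarith), mul_zero]

theorem profile_nonneg (c x : ℝ) : 0 ≤ profile c x := by unfold profile; positivity

theorem profile_le_one {c x : ℝ} (hc : 0 ≤ c) (hx : 0 ≤ x) : profile c x ≤ 1 := by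
  have h0 : 0 ≤ c * x := mul_nonneg hc hx
  have h1 : max (1 - c * x / 2) 0 ≤ 1 := max_le (by linarith) zero_le_one
  exact pow_le_one₀ (le_max_right _ _) h1

theorem measurable_profileDeriv2 (c : ℝ) : Measurable (profileDeriv2 c) := by
  unfold profileDeriv2
  exact Measurable.ite (measurableSet_lt (by fun_prop) measurable_const) measurable_const
    measurable_const

theorem isH2_profile {a c : ℝ} (hc : 0 < c) (v w : ℂ) :
    IsH2 a (fun x => v * (profile c x : ℝ) + w * (profile c (a - x) : ℝ))
      (fun x => v * (profileDeriv c x : ℝ) - w * (profileDeriv c (a - x) : ℝ))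
      (fun x => v * (profileDeriv2 c x : ℝ) + w * (profileDeriv2 c (a - x) : ℝ)) := by
  have hsub : ∀ x : ℝ, HasDerivAt (fun x : ℝ => a - x) (-1) x := fun x =>
    (hasDerivAt_id x).const_sub a
  refine .of_hasDerivAt_off_countable (s := {2 / c, a - 2 / c}) ?_ (fun x => ?_) ?_
    (fun x hx => ?_) ?_
  · exact (Set.toFinite _).countable
  · refine (((hasDerivAt_profile c x).ofReal_comp.const_mul v).add
      (((hasDerivAt_profile c (a - x)).comp x (hsub x)).ofReal_comp.const_mul w)).congr_deriv ?_
    push_cast; ring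
  · unfold profileDeriv; fun_prop
  · simp only [Set.mem_insert_iff, Set.mem_singleton_iff, not_or] at hx
    have h1 : c * x ≠ 2 := fun h => hx.1 (by field_simp; linarith)
    have h2 : c * (a - x) ≠ 2 := fun h => hx.2 (by field_simp; linarith)
    refine (((hasDerivAt_profileDeriv h1).ofReal_comp.const_mul v).sub
      (((hasDerivAt_profileDeriv h2).comp x (hsub x)).ofReal_comp.const_mul w)).congr_deriv ?_
    push_cast; ring
  · have hb : ∀ x, ‖profileDeriv2 c x‖ ≤ c ^ 2 / 2 := by
      intro x
      unfold profileDeriv2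
      split_ifs
      · rw [Real.norm_of_nonneg (by positivity)]
      · rw [norm_zero]; positivity
    have hm := measurable_profileDeriv2 c
    refine MemLp.of_bound (C := ‖v‖ * (c ^ 2 / 2) + ‖w‖ * (c ^ 2 / 2)) ?_ (ae_of_all _ fun x => ?_)
    · exact Measurable.aestronglyMeasurable (by fun_prop)
    · refine (norm_add_le _ _).trans ?_
      rw [norm_mul, norm_mul, Complex.norm_real, Complex.norm_real]
      gcongr
      · exact hb _
      · exact hb _

/-- The bound on the Rayleigh quotient holds pointwise: the two summands of the trial function have
disjoint supports, on which `χ'' = c² / 2`, and `χ² ≤ χ`. -/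
theorem re_star_mul_profile_le {a c x : ℝ} (hc : 0 < c) (ha : 4 ≤ c * a) (hx : x ∈ Set.Icc 0 a)
    (v w : ℂ) :
    (star (v * (profile c x : ℝ) + w * (profile c (a - x) : ℝ)) *
      -(v * (profileDeriv2 c x : ℝ) + w * (profileDeriv2 c (a - x) : ℝ))).re ≤
      -(c ^ 2 / 2) * ‖v * (profile c x : ℝ) + w * (profile c (a - x) : ℝ)‖ ^ 2 := by
  have main : ∀ (z : ℂ) (y : ℝ), 0 ≤ y → ∀ d, (profile c y * d = profile c y * (c ^ 2 / 2)) →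
      (star (z * (profile c y : ℝ)) * -(z * (d : ℝ))).re ≤
        -(c ^ 2 / 2) * ‖z * (profile c y : ℝ)‖ ^ 2 := by
    intro z y hy d hd
    have e : star (z * (profile c y : ℝ)) * -(z * (d : ℝ)) =
        ((-(‖z‖ ^ 2 * (profile c y * d)) : ℝ) : ℂ) := by
      have h1 : star z * z = ((‖z‖ ^ 2 : ℝ) : ℂ) := by
        rw [mul_comm, Complex.star_def, Complex.mul_conj, Complex.normSq_eq_norm_sq]
      have h2 : star ((profile c y : ℝ) : ℂ) = (profile c y : ℝ) := Complex.conj_ofReal _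
      rw [star_mul', h2]
      push_cast at h1 ⊢
      linear_combination -(profile c y : ℂ) * d * h1
    rw [e, Complex.ofReal_re, hd, norm_mul, Complex.norm_real, Real.norm_eq_abs, mul_pow, sq_abs]
    have h2 : profile c y ^ 2 ≤ profile c y := by
      have := profile_le_one hc.le hy
      have := profile_nonneg c y
      nlinarith
    have h3 : 0 ≤ ‖z‖ ^ 2 * (c ^ 2 / 2) := by positivity
    nlinarith
  have hself : ∀ y, profile c y * profileDeriv2 c y = profile c y * (c ^ 2 / 2) := by
    intro y
    by_cases h : c * y < 2
    · rw [profileDeriv2, if_pos h]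
    · rw [profile_eq_zero (not_lt.1 h), zero_mul, zero_mul]
  by_cases h : c * x < 2
  · have h1 : 2 ≤ c * (a - x) := by linarith
    have h2 : profileDeriv2 c (a - x) = 0 := by rw [profileDeriv2, if_neg h1.not_gt]
    rw [profile_eq_zero h1, h2]
    simp only [Complex.ofReal_zero, mul_zero, add_zero]
    exact main v x hx.1 _ (hself x)
  · have h1 : 2 ≤ c * x := not_lt.1 h
    have h2 : profileDeriv2 c x = 0 := by rw [profileDeriv2, if_neg h]
    rw [profile_eq_zero h1, h2]
    simp only [Complex.ofReal_zero, mul_zero, zero_add]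
    exact main w (a - x) (by linarith [hx.2]) _ (hself _)

variable {E : Type*} [Fintype E] [DecidableEq E] {l : E → ℝ} {P L : Matrix (E ⊕ E) (E ⊕ E) ℂ}

/-- A positive eigenvalue `c` of `L` with eigenvector `v` binds a state: on long edges the function
with boundary values `v` and inward derivatives `-c v` which decays to zero within the edges is in
the domain of `-Δ`, and its Rayleigh quotient is at most `-c² / 2`. -/
theorem exists_isTrialFamily_of_hasEigenvalue (hPL : IsBoundaryData P L) (hl : ∀ e, 0 < l e)
    {c : ℝ} (hc : 0 < c) (hev : Module.End.HasEigenvalue (Matrix.toLin' L) (c : ℂ))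
    (hlc : ∀ e, 4 ≤ c * l e) :
    ∃ p : Fin 1 → laplacianGraph l P L, IsTrialFamily p (-(c ^ 2 / 2)) := by
  obtain ⟨v, hv⟩ := hev.exists_hasEigenvector
  have hLv : L.mulVec v = (c : ℂ) • v := by
    simpa [Matrix.toLin'_apply] using hv.apply_eq_smul
  have hc' : (c : ℂ) ≠ 0 := by exact_mod_cast hc.ne'
  have hPv : P.mulVec v = 0 := by
    have h1 : (c : ℂ) • P.mulVec v = 0 := by
      rw [← Matrix.mulVec_smul, ← hLv, Matrix.mulVec_mulVec, hPL.proj_mul, Matrix.zero_mulVec]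
    exact (smul_eq_zero.1 h1).resolve_left hc'
  let u : E → ℝ → ℂ := fun e x =>
    v (.inl e) * (profile c x : ℝ) + v (.inr e) * (profile c (l e - x) : ℝ)
  let du : E → ℝ → ℂ := fun e x =>
    v (.inl e) * (profileDeriv c x : ℝ) - v (.inr e) * (profileDeriv c (l e - x) : ℝ)
  have h0 : profile c 0 = 1 := by simp [profile]
  have h0' : profileDeriv c 0 = -c := by simp [profileDeriv]
  have hz : ∀ e, profile c (l e) = 0 := fun e => profile_eq_zero (by linarith [hlc e])
  have hz' : ∀ e, profileDeriv c (l e) = 0 := fun e => profileDeriv_eq_zero (by linarith [hlc e])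
  have hbv : boundaryValues l u = v := by
    ext i; rcases i with e | e <;> simp [boundaryValues, u, h0, hz]
  have hbd : inwardDerivatives l du = -((c : ℂ) • v) := by
    ext i; rcases i with e | e <;> simp [inwardDerivatives, du, h0', hz', mul_comm]
  have hb : (P + L).mulVec (boundaryValues l u) + (1 - P).mulVec (inwardDerivatives l du) = 0 := by
    rw [hbv, hbd, Matrix.add_mulVec, hPv, hLv, Matrix.sub_mulVec, Matrix.mulVec_neg,
      Matrix.mulVec_neg, Matrix.mulVec_smul P, hPv, Matrix.one_mulVec]
    simp
  obtain ⟨p, hp⟩ := exists_isRep (fun e => isH2_profile hc (v (.inl e)) (v (.inr e))) hb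
  refine ⟨fun _ => p, fun _ hp0 => hv.2 ?_, fun i j hij => absurd (Subsingleton.elim i j) hij,
    fun i j hij => absurd (Subsingleton.elim i j) hij, fun _ => ?_⟩
  · have hrep : ∀ e, Set.EqOn (u e) 0 (Set.Icc 0 (l e)) := by
      intro e x hx
      have h1 : p.1.1 e =ᵐ[volume.restrict (Set.Ioo 0 (l e))] (0 : ℝ → ℂ) := by
        rw [hp0]; exact Lp.coeFn_zero _ _ _
      exact (rep_eqOn hl p (hp.fst_ae e) (hp.isH2 e).continuousOn hx).symm.trans
        (rep_eqOn hl p h1 continuousOn_const hx)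
    rw [← hbv]
    ext i
    rcases i with e | e
    · exact hrep e ⟨le_rfl, (hl e).le⟩
    · exact hrep e ⟨(hl e).le, le_rfl⟩
  · rw [inner_self_eq_sum hl hp.fst_ae, inner_eq_sum_integral hl hp.fst_ae hp.snd_ae,
      Complex.re_sum, Finset.mul_sum]
    refine Finset.sum_le_sum fun e _ => ?_
    have hcu : ContinuousOn (u e) (Set.uIcc 0 (l e)) := by
      rw [Set.uIcc_of_le (hl e).le]; exact (hp.isH2 e).continuousOn
    have hi := (((hp.isH2 e).intervalIntegrable ⟨(hl e).le, le_rfl⟩).neg).continuousOn_mul hcu.star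
    rw [← intervalIntegral.integral_const_mul]
    have e1 : (∫ x in (0 : ℝ)..l e, star (u e x) * (-(fun x =>
        v (.inl e) * (profileDeriv2 c x : ℝ) +
        v (.inr e) * (profileDeriv2 c (l e - x) : ℝ)) : ℝ → ℂ) x).re =
        ∫ x in (0 : ℝ)..l e, (star (u e x) * (-(fun x => v (.inl e) * (profileDeriv2 c x : ℝ) +
        v (.inr e) * (profileDeriv2 c (l e - x) : ℝ)) : ℝ → ℂ) x).re :=
      (Complex.reCLM.intervalIntegral_comp_comm hi).symm
    rw [e1]
    refine intervalIntegral.integral_mono_on (hl e).le ?_ ?_ fun x hx =>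
      re_star_mul_profile_le hc (hlc e) hx _ _
    · exact ⟨hi.1.re, hi.2.re⟩
    · exact ((hcu.norm.pow 2).intervalIntegrable).const_mul _

end BoundState

section EigenvalueBounds

variable {E : Type*} [Fintype E] [DecidableEq E] [Nonempty E] {l : E → ℝ}
  {P L : Matrix (E ⊕ E) (E ⊕ E) ℂ}

theorem nonempty_eigenvalueBounds (hPL : IsBoundaryData P L) (hl : ∀ e, 0 < l e) (n : ℕ) :
    (eigenvalueBounds l P L n).Nonempty := by
  obtain ⟨C, hC⟩ := exists_isTrialFamily (P := P) (L := L) hl n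
  obtain ⟨p, hp⟩ := hC 1 one_pos
  have hl1 : (fun e => 1 * l e) = l := by ext e; rw [one_mul]
  have hmem := hp.mem_eigenvalueBounds hPL (by simpa using hl) (lt_add_one _)
  rw [hl1] at hmem
  exact ⟨_, hmem⟩

theorem eigenvalue_mono (hPL : IsBoundaryData P L) (hl : ∀ e, 0 < l e) :
    Monotone (eigenvalue l P L) := by
  refine monotone_nat_of_le_succ fun n =>
    csInf_le_csInf (bddBelow_eigenvalueBounds hPL hl n) (nonempty_eigenvalueBounds hPL hl _) ?_
  rintro x ⟨f, hf, h⟩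
  exact ⟨f ∘ Fin.castSucc, hf.comp _ (Fin.castSucc_injective _), fun i => h _⟩

theorem le_eigenvalue_of_node (hPL : IsBoundaryData P L) (hl : ∀ e, 0 < l e) {R : ℝ}
    (hR : ∀ e, l e ≤ R) {M n : ℕ} (hn : (M + 2) * Fintype.card E ≤ n) :
    ((M + 1) / R) ^ 2 ≤ eigenvalue l P L n := by
  have hR0 : 0 < R := (hl (Classical.arbitrary E)).trans_le (hR _)
  refine le_csInf (nonempty_eigenvalueBounds hPL hl n) ?_
  rintro x ⟨f, hf, h⟩
  have h1 := one_le_of_linearIndependent hPL hl hR hn hf h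
  have h2 : (R / ((M : ℝ) + 1)) ^ 2 * ((M + 1) / R) ^ 2 = 1 := by
    rw [← mul_pow]; field_simp
  have h3 : 0 < (R / ((M : ℝ) + 1)) ^ 2 := by positivity
  exact le_of_mul_le_mul_left (h2.trans_le h1) h3

/-- The eigenvalues grow at least quadratically, at the rate expected from Weyl's law up to a
constant. -/
theorem sq_le_eigenvalue (hPL : IsBoundaryData P L) (hl : ∀ e, 0 < l e) {R : ℝ}
    (hR : ∀ e, l e ≤ R) (j : ℕ) :
    (j / (Fintype.card E * R)) ^ 2 ≤ eigenvalue l P L (j + 2 * Fintype.card E) := by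
  have hq : 0 < Fintype.card E := Fintype.card_pos
  have hR0 : 0 < R := (hl (Classical.arbitrary E)).trans_le (hR _)
  have h1 := le_eigenvalue_of_node hPL hl hR (M := j / Fintype.card E)
    (n := j + 2 * Fintype.card E) (by rw [add_mul]; gcongr; exact Nat.div_mul_le_self _ _)
  refine le_trans ?_ h1
  have h2 : (j : ℝ) ≤ ((j / Fintype.card E : ℕ) + 1) * Fintype.card E := by
    exact_mod_cast (Nat.lt_mul_of_div_lt (Nat.lt_succ_self _) hq).le
  have hq' : (0 : ℝ) < Fintype.card E := by exact_mod_cast hq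
  refine pow_le_pow_left₀ (by positivity) ?_ 2
  rw [div_le_div_iff₀ (by positivity) hR0]
  nlinarith

theorem eigenvalue_nonneg (hPL : IsBoundaryData P L) (hl : ∀ e, 0 < l e) (hL : (-L).PosSemidef)
    (n : ℕ) : 0 ≤ eigenvalue l P L n := by
  refine le_csInf (nonempty_eigenvalueBounds hPL hl n) fun x hx => ?_
  obtain ⟨κ, hκ, hne⟩ := exists_eigenspace_ne_bot hx
  obtain ⟨f, hf, hf0⟩ := (Submodule.ne_bot_iff _).1 hne
  have h1 := re_inner_nonneg hPL hl hL (mem_eigenspace.1 hf)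
  rw [inner_smul_right, Complex.re_ofReal_mul, ← norm_sq_eq_re_inner_self] at h1
  have h2 : 0 < ‖f‖ ^ 2 := by positivity
  exact (nonneg_of_mul_nonneg_left h1 h2).trans hκ

end EigenvalueBounds

/-! ### Bose sums and the thermodynamic limit -/

section BoseSums

theorem one_div_exp_sub_one_anti {x y : ℝ} (hx : 0 < x) (hxy : x ≤ y) :
    1 / (Real.exp y - 1) ≤ 1 / (Real.exp x - 1) := by
  have h1 : 0 < Real.exp x - 1 := sub_pos.2 (Real.one_lt_exp_iff.2 hx)
  have h2 : Real.exp x ≤ Real.exp y := Real.exp_le_exp.2 hxy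
  exact one_div_le_one_div_of_le h1 (by linarith)

theorem one_div_exp_sub_one_pos {x : ℝ} (hx : 0 < x) : 0 < 1 / (Real.exp x - 1) :=
  one_div_pos.2 (sub_pos.2 (Real.one_lt_exp_iff.2 hx))

theorem one_div_exp_add_sub_one_le {x d : ℝ} (hx : 0 < x) (hd : 0 ≤ d) :
    1 / (Real.exp (x + d) - 1) ≤ Real.exp (-d) * (1 / (Real.exp x - 1)) := by
  have h1 : 0 < Real.exp x - 1 := sub_pos.2 (Real.one_lt_exp_iff.2 hx)
  have h2 : 1 ≤ Real.exp d := Real.one_le_exp hd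
  rw [Real.exp_neg, ← one_div, one_div_mul_one_div]
  refine one_div_le_one_div_of_le (by positivity) ?_
  rw [Real.exp_add]
  nlinarith

/-- A sum of Bose factors with linearly growing energies is dominated by a geometric series. -/
theorem summable_and_tsum_bose_le {x : ℕ → ℝ} {x₀ a : ℝ} (hx₀ : 0 < x₀) (ha : 0 < a)
    (hx : ∀ j : ℕ, x₀ + j * a ≤ x j) :
    Summable (fun j => 1 / (Real.exp (x j) - 1)) ∧
      ∑' j, 1 / (Real.exp (x j) - 1) ≤ (1 - Real.exp (-a))⁻¹ * (1 / (Real.exp x₀ - 1)) := by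
  have hr : Real.exp (-a) < 1 := Real.exp_lt_one_iff.2 (by linarith)
  have hs := (hasSum_geometric_of_lt_one (Real.exp_pos _).le hr).mul_right (1 / (Real.exp x₀ - 1))
  have hpos : ∀ j : ℕ, 0 < x₀ + j * a := fun j => by positivity
  have hle : ∀ j, 1 / (Real.exp (x j) - 1) ≤ Real.exp (-a) ^ j * (1 / (Real.exp x₀ - 1)) := by
    intro j
    refine (one_div_exp_sub_one_anti (hpos j) (hx j)).trans ?_
    refine (one_div_exp_add_sub_one_le hx₀ (by positivity)).trans (le_of_eq ?_)
    rw [← Real.exp_nat_mul]; congr 2; ring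
  have hsum : Summable (fun j => 1 / (Real.exp (x j) - 1)) := Summable.of_nonneg_of_le
    (fun j => (one_div_exp_sub_one_pos ((hpos j).trans_le (hx j))).le) hle hs.summable
  exact ⟨hsum, (hsum.tsum_le_tsum hle hs.summable).trans_eq hs.tsum_eq⟩

theorem summable_bose {k : ℕ → ℝ} (hk : Monotone k) {q : ℕ} {A : ℝ} (hA : 0 < A)
    (hgrow : ∀ j : ℕ, (j * A) ^ 2 ≤ k (j + q)) {β m : ℝ} (hβ : 0 < β) (hm : m < k 0) :
    Summable (fun n => 1 / (Real.exp (β * (k n - m)) - 1)) := by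
  rw [← summable_nat_add_iff q]
  set d := β * (k 0 - m) with hd
  have hdpos : 0 < d := mul_pos hβ (sub_pos.2 hm)
  set D := d + β * (1 + |m|) with hD
  have hDpos : 0 < D := by positivity
  -- the energies are bounded below by a convex combination of `d` and a linear function
  set θ := d / (2 * D) with hθ
  have hθD : θ * D = d / 2 := by rw [hθ]; field_simp
  have hθ0 : 0 < θ := by positivity
  have hθ1 : θ ≤ 1 := by
    have : d ≤ D := by rw [hD]; have : 0 ≤ β * (1 + |m|) := by positivity
                       linarith
    nlinarith
  refine (summable_and_tsum_bose_le (x₀ := d / 2) (a := 2 * θ * β * A) (by positivity)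
    (by positivity) fun j => ?_).1
  have h1 : d ≤ β * (k (j + q) - m) := by
    have := hk (Nat.zero_le (j + q)); rw [hd]; gcongr
  have h2 : β * (2 * (j * A) - 1 - |m|) ≤ β * (k (j + q) - m) := by
    have := hgrow j
    have := le_abs_self m
    refine mul_le_mul_of_nonneg_left ?_ hβ.le
    nlinarith [sq_nonneg ((j : ℝ) * A - 1)]
  nlinarith [mul_le_mul_of_nonneg_left h1 (sub_nonneg.2 hθ1), mul_le_mul_of_nonneg_left h2 hθ0.le]

/-- Existence and uniqueness of the chemical potential for a sequence of energies that grows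
quadratically. -/
theorem existsUnique_chemicalPotential {k : ℕ → ℝ} (hk : Monotone k) {q : ℕ} {A : ℝ} (hA : 0 < A)
    (hgrow : ∀ j : ℕ, (j * A) ^ 2 ≤ k (j + q)) {β w ρ : ℝ} (hβ : 0 < β) (hw : 0 < w)
    (hρ : 0 < ρ) :
    ∃! m : ℝ, m < k 0 ∧ HasSum (fun n => w * (1 / (Real.exp (β * (k n - m)) - 1))) ρ := by
  have hx : ∀ m < k 0, ∀ n, 0 < β * (k n - m) := fun m hm n =>
    mul_pos hβ (sub_pos.2 (hm.trans_le (hk (Nat.zero_le n))))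
  have hsum : ∀ m < k 0, Summable (fun n => w * (1 / (Real.exp (β * (k n - m)) - 1))) :=
    fun m hm => (summable_bose hk hA hgrow hβ hm).mul_left w
  have hpos : ∀ m < k 0, ∀ n, 0 < w * (1 / (Real.exp (β * (k n - m)) - 1)) := fun m hm n =>
    mul_pos hw (one_div_exp_sub_one_pos (hx m hm n))
  let F : ℝ → ℝ := fun m => ∑' n, w * (1 / (Real.exp (β * (k n - m)) - 1))
  refine existsUnique_of_exists_of_unique ?_ ?_
  · -- at `m₂` the ground state alone has density `ρ`
    set m₂ := k 0 - Real.log (1 + w / ρ) / β with hm₂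
    have hlog : 0 < Real.log (1 + w / ρ) := Real.log_pos (by
      have : 0 < w / ρ := by positivity
      linarith)
    have hm₂k : m₂ < k 0 := by
      have : 0 < Real.log (1 + w / ρ) / β := by positivity
      linarith
    have hF₂ : ρ ≤ F m₂ := by
      refine le_trans (le_of_eq ?_) ((hsum m₂ hm₂k).le_tsum 0 fun n _ => (hpos m₂ hm₂k n).le)
      have h1 : β * (k 0 - m₂) = Real.log (1 + w / ρ) := by rw [hm₂]; field_simp; ring
      rw [h1, Real.exp_log (by positivity), add_sub_cancel_left]
      field_simp
    have hF₂pos : 0 < F m₂ := hρ.trans_le hF₂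
    -- lowering `m` by `d` scales all densities by at most `exp (-β d)`
    set d := Real.log (F m₂ / ρ) / β with hd
    have hlog2 : 0 ≤ Real.log (F m₂ / ρ) := Real.log_nonneg ((one_le_div hρ).2 hF₂)
    have hd0 : 0 ≤ d := by positivity
    have hF₁ : F (m₂ - d) ≤ ρ := by
      have h1 : ∀ n, w * (1 / (Real.exp (β * (k n - (m₂ - d))) - 1)) ≤
          Real.exp (-(β * d)) * (w * (1 / (Real.exp (β * (k n - m₂)) - 1))) := by
        intro n
        have h2 := one_div_exp_add_sub_one_le (hx m₂ hm₂k n) (mul_nonneg hβ.le hd0)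
        rw [show β * (k n - (m₂ - d)) = β * (k n - m₂) + β * d by ring]
        calc _ ≤ w * (Real.exp (-(β * d)) * (1 / (Real.exp (β * (k n - m₂)) - 1))) := by gcongr
          _ = _ := by ring
      have h3 := (hsum (m₂ - d) (by linarith)).tsum_le_tsum h1 ((hsum m₂ hm₂k).mul_left _)
      refine (h3.trans_eq tsum_mul_left).trans (le_of_eq ?_)
      have h4 : β * d = Real.log (F m₂ / ρ) := by rw [hd]; field_simp
      change Real.exp (-(β * d)) * F m₂ = ρ
      rw [h4, Real.exp_neg, Real.exp_log (by positivity)]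
      field_simp
    have hcont : ContinuousOn F (Set.Icc (m₂ - d) m₂) := by
      refine continuousOn_tsum (fun n => ?_) (hsum m₂ hm₂k) fun n m hm => ?_
      · refine continuousOn_const.mul (continuousOn_const.div (by fun_prop) fun m hm => ?_)
        exact (sub_pos.2 (Real.one_lt_exp_iff.2 (hx m (hm.2.trans_lt hm₂k) n))).ne'
      · rw [Real.norm_of_nonneg (hpos m (hm.2.trans_lt hm₂k) n).le]
        have h5 : β * (k n - m₂) ≤ β * (k n - m) := by have := hm.2; gcongr
        have := one_div_exp_sub_one_anti (hx m₂ hm₂k n) h5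
        gcongr
    obtain ⟨m, hm, hFm⟩ := intermediate_value_Icc (by linarith) hcont ⟨hF₁, hF₂⟩
    have hmk := hm.2.trans_lt hm₂k
    exact ⟨m, hmk, hFm ▸ (hsum m hmk).hasSum⟩
  · have hlt : ∀ m m', m < m' → m' < k 0 →
        HasSum (fun n => w * (1 / (Real.exp (β * (k n - m)) - 1))) ρ →
        HasSum (fun n => w * (1 / (Real.exp (β * (k n - m')) - 1))) ρ → False := by
      intro m m' hmm hm' h h'
      have h1 : ∀ n, w * (1 / (Real.exp (β * (k n - m)) - 1)) <
          w * (1 / (Real.exp (β * (k n - m')) - 1)) := by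
        intro n
        have h2 := sub_pos.2 (Real.one_lt_exp_iff.2 (hx m' hm' n))
        have h3 : β * (k n - m') < β * (k n - m) := by gcongr
        have h4 := Real.exp_lt_exp.2 h3
        exact mul_lt_mul_of_pos_left (one_div_lt_one_div_of_lt h2 (by linarith)) hw
      exact (hasSum_lt (fun n => (h1 n).le) (h1 0) h h').false
    rintro m m' ⟨hm, h⟩ ⟨hm', h'⟩
    rcases lt_trichotomy m m' with hlt' | rfl | hlt'
    · exact (hlt m m' hlt' hm' h h').elim
    · rfl
    · exact (hlt m' m hlt' hm h' h).elim

end BoseSums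

section Length

variable {V E : Type*}

theorem CompactMetricGraph.scaledLen_pos (Γ : CompactMetricGraph V E) {η : ℝ} (hη : 0 < η)
    (e : E) : 0 < Γ.scaledLen η e :=
  mul_pos hη (Γ.len_pos e)

theorem CompactMetricGraph.sum_scaledLen [Fintype E] (Γ : CompactMetricGraph V E) (η : ℝ) :
    ∑ e, Γ.scaledLen η e = η * ∑ e, Γ.len e :=
  (Finset.mul_sum _ _ _).symm

theorem CompactMetricGraph.sum_len_pos [Fintype E] [Nonempty E] (Γ : CompactMetricGraph V E) :
    0 < ∑ e, Γ.len e :=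
  Finset.sum_pos (fun e _ => Γ.len_pos e) Finset.univ_nonempty

end Length

section ThermodynamicLimit

variable {V E : Type*} [Fintype E] [DecidableEq E] [Nonempty E] {P L : Matrix (E ⊕ E) (E ⊕ E) ℂ}

theorem occupationDensity_nonneg (hPL : IsBoundaryData P L) {l : E → ℝ} (hl : ∀ e, 0 < l e)
    {β m : ℝ} (hβ : 0 < β) (hm : m < eigenvalue l P L 0) (n : ℕ) :
    0 ≤ occupationDensity l P L β m n := by
  have h1 := eigenvalue_mono hPL hl (Nat.zero_le n)
  have h2 := one_div_exp_sub_one_pos (mul_pos hβ (sub_pos.2 (hm.trans_le h1)))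
  have h3 : 0 ≤ ∑ e, l e := Finset.sum_nonneg fun e _ => (hl e).le
  unfold occupationDensity
  positivity

theorem occupationDensity_anti (hPL : IsBoundaryData P L) {l : E → ℝ} (hl : ∀ e, 0 < l e)
    {β m : ℝ} (hβ : 0 < β) (hm : m < eigenvalue l P L 0) (n : ℕ) :
    occupationDensity l P L β m n ≤ occupationDensity l P L β m 0 := by
  have h1 := eigenvalue_mono hPL hl (Nat.zero_le n)
  have h2 := one_div_exp_sub_one_anti (mul_pos hβ (sub_pos.2 hm))
    (mul_le_mul_of_nonneg_left (sub_le_sub_right h1 m) hβ.le)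
  have h3 : 0 ≤ ∑ e, l e := Finset.sum_nonneg fun e _ => (hl e).le
  unfold occupationDensity
  gcongr

theorem existsUnique_isChemicalPotential (hPL : IsBoundaryData P L) {l : E → ℝ}
    (hl : ∀ e, 0 < l e) {β ρ : ℝ} (hβ : 0 < β) (hρ : 0 < ρ) :
    ∃! m : ℝ, IsChemicalPotential l P L ρ β m := by
  have hR : ∀ e, l e ≤ ∑ e, l e := fun e =>
    Finset.single_le_sum (fun e _ => (hl e).le) (Finset.mem_univ e)
  have hS : 0 < ∑ e, l e := Finset.sum_pos (fun e _ => hl e) Finset.univ_nonempty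
  have hq : (0 : ℝ) < Fintype.card E := by exact_mod_cast Fintype.card_pos
  refine existsUnique_chemicalPotential (eigenvalue_mono hPL hl) (q := 2 * Fintype.card E)
    (A := 1 / (Fintype.card E * ∑ e, l e)) (by positivity) (fun j => ?_) hβ (by positivity) hρ
  rw [mul_one_div]
  exact sq_le_eigenvalue hPL hl hR j

/-- Without attractive boundary conditions the lowest eigenvalues are of order `η⁻²`. If one
eigenstate had density `ε`, so that `μ` lies within order `1 / (ε η)` of its energy, then
arbitrarily many eigenstates would have density at least `ε / 4`. -/
theorem eventually_occupationDensity_le (Γ : CompactMetricGraph V E) (hPL : IsBoundaryData P L)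
    (hL : (-L).PosSemidef) {ρ β : ℝ} (hβ : 0 < β) {μ : ℝ → ℝ}
    (hμ : ∀ η : ℝ, 0 < η → IsChemicalPotential (Γ.scaledLen η) P L ρ β (μ η)) (n : ℕ) {ε : ℝ}
    (hε : 0 < ε) :
    ∀ᶠ η in atTop, occupationDensity (Γ.scaledLen η) P L β (μ η) n ≤ ε := by
  obtain ⟨J, hJ⟩ := exists_nat_gt (4 * ρ / ε)
  obtain ⟨C, hC⟩ := exists_isTrialFamily (P := P) (L := L) Γ.len_pos J
  set Λ := ∑ e, Γ.len e with hΛ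
  have hΛ0 : 0 < Λ := Γ.sum_len_pos
  filter_upwards [eventually_gt_atTop 0, eventually_ge_atTop (β * |C| * ε * Λ),
    eventually_ge_atTop (2 / (ε * Λ))] with η hη h1 h2
  by_contra hcon
  push Not at hcon
  have hl := Γ.scaledLen_pos hη
  obtain ⟨hm, hsum⟩ := hμ η hη
  set k := eigenvalue (Γ.scaledLen η) P L with hk
  set S := η * Λ with hS
  have hS0 : 0 < S := mul_pos hη hΛ0
  have hocc : ∀ j, occupationDensity (Γ.scaledLen η) P L β (μ η) j =
      (1 / S) * (1 / (Real.exp (β * (k j - μ η)) - 1)) := fun j => by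
    rw [occupationDensity, Γ.sum_scaledLen]
  have hmono := eigenvalue_mono hPL hl
  have hz : ∀ j, 0 < β * (k j - μ η) := fun j =>
    mul_pos hβ (sub_pos.2 (hm.trans_le (hmono (Nat.zero_le j))))
  have hzn : β * (k n - μ η) ≤ 1 / (ε * S) := by
    rw [hocc] at hcon
    have h3 := sub_pos.2 (Real.one_lt_exp_iff.2 (hz n))
    rw [one_div_mul_one_div_rev, lt_one_div hε (by positivity)] at hcon
    have h4 : Real.exp (β * (k n - μ η)) - 1 < 1 / (ε * S) := by
      rw [← lt_div_iff₀ hS0, div_div] at hcon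
      exact hcon
    linarith [Real.add_one_le_exp (β * (k n - μ η))]
  have hkJ : k J ≤ |C| / η ^ 2 := by
    obtain ⟨p, hp⟩ := hC η hη
    refine (hp.eigenvalue_le hPL hl).trans ?_
    gcongr
    exact le_abs_self C
  have hkn : 0 ≤ k n := eigenvalue_nonneg hPL hl hL n
  have hεS : 2 / (ε * S) ≤ 1 := by
    rw [div_le_one (by positivity)]
    rw [div_le_iff₀ (by positivity)] at h2
    calc 2 ≤ η * (ε * Λ) := h2
      _ = ε * S := by rw [hS]; ring
  have hCη : β * (|C| / η ^ 2) ≤ 1 / (ε * S) := by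
    rw [← mul_div_assoc, div_le_div_iff₀ (by positivity) (by positivity)]
    calc β * |C| * (ε * S) = (β * |C| * ε * Λ) * η := by rw [hS]; ring
      _ ≤ η * η := by gcongr
      _ = 1 * η ^ 2 := by ring
  have hlow : ∀ j ∈ Finset.range (J + 1),
      ε / 4 ≤ occupationDensity (Γ.scaledLen η) P L β (μ η) j := by
    intro j hj
    have hkj : k j ≤ k J := hmono (Nat.lt_succ_iff.1 (Finset.mem_range.1 hj))
    have hzj : β * (k j - μ η) ≤ 2 / (ε * S) := by
      calc β * (k j - μ η) ≤ β * (|C| / η ^ 2) + β * (k n - μ η) := by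
            rw [← mul_add]; gcongr; linarith
        _ ≤ 1 / (ε * S) + 1 / (ε * S) := add_le_add hCη hzn
        _ = _ := by ring
    have hexp : Real.exp (β * (k j - μ η)) - 1 ≤ 4 / (ε * S) := by
      have h5 := Real.abs_exp_sub_one_le (x := β * (k j - μ η))
        (by rw [abs_of_pos (hz j)]; linarith)
      rw [abs_of_pos (hz j)] at h5
      calc _ ≤ 2 * (β * (k j - μ η)) := (le_abs_self _).trans h5
        _ ≤ 2 * (2 / (ε * S)) := by gcongr
        _ = _ := by ring
    have h6 := sub_pos.2 (Real.one_lt_exp_iff.2 (hz j))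
    rw [hocc]
    calc ε / 4 = (1 / S) * (1 / (4 / (ε * S))) := by field_simp
      _ ≤ _ := by gcongr
  have h7 := sum_le_hasSum (Finset.range (J + 1))
    (fun j _ => occupationDensity_nonneg hPL hl hβ hm j) hsum
  have h8 := Finset.card_nsmul_le_sum _ _ _ hlow
  rw [Finset.card_range, nsmul_eq_mul] at h8
  rw [div_lt_iff₀ hε] at hJ
  push_cast at h8
  nlinarith

theorem not_macroscopicallyOccupied (Γ : CompactMetricGraph V E) (hPL : IsBoundaryData P L)
    (hL : (-L).PosSemidef) {ρ β : ℝ} (hβ : 0 < β) {μ : ℝ → ℝ}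
    (hμ : ∀ η : ℝ, 0 < η → IsChemicalPotential (Γ.scaledLen η) P L ρ β (μ η)) (n : ℕ) :
    ¬ MacroscopicallyOccupied Γ P L β μ n := by
  intro h
  obtain ⟨ε, hε, hlt⟩ := EReal.lt_iff_exists_real_btwn.1 h
  refine hlt.not_ge (limsup_le_of_le (by isBoundedDefault) ?_)
  filter_upwards [eventually_occupationDensity_le Γ hPL hL hβ hμ n (EReal.coe_pos.1 hε)] with η hη
  exact_mod_cast hη

/-- If the chemical potential stays below `-δ < 0`, the densities of all eigenstates but the first
`2 |E|` add up to at most a multiple of `1 / β`, uniformly in `η`. -/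
theorem exists_tsum_occupationDensity_le (Γ : CompactMetricGraph V E) (hPL : IsBoundaryData P L)
    {δ : ℝ} (hδ : 0 < δ) :
    ∃ K : ℝ, 0 < K ∧ ∀ β η m : ℝ, 1 ≤ β → 1 ≤ η → m ≤ -δ →
      ∑' j, occupationDensity (Γ.scaledLen η) P L β m (j + 2 * Fintype.card E) ≤ K / β := by
  set Λ := ∑ e, Γ.len e with hΛ
  have hΛ0 : 0 < Λ := Γ.sum_len_pos
  have hR : ∀ e, Γ.len e ≤ Λ := fun e =>
    Finset.single_le_sum (fun e _ => (Γ.len_pos e).le) (Finset.mem_univ e)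
  set q := Fintype.card E with hq
  have hq0 : (0 : ℝ) < q := by exact_mod_cast Fintype.card_pos
  set t := √(δ / 2) with ht
  have ht0 : 0 < t := Real.sqrt_pos.2 (by positivity)
  have ht2 : t ^ 2 = δ / 2 := Real.sq_sqrt (by positivity)
  refine ⟨(1 + q * Λ / (2 * t)) / Λ * (2 / δ), by positivity, fun β η m hβ hη hm => ?_⟩
  have hβ0 : 0 < β := by linarith
  have hη0 : 0 < η := by linarith
  have hl := Γ.scaledLen_pos hη0
  set a := 2 * β * t / (q * (η * Λ)) with ha
  have ha0 : 0 < a := by positivity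
  -- the parabola `y ^ 2` lies above its tangent line `2 t y - t ^ 2`, whose slope is chosen so
  -- that half of the gap `δ` remains
  have hx : ∀ j : ℕ, β * δ / 2 + j * a ≤
      β * (eigenvalue (Γ.scaledLen η) P L (j + 2 * q) - m) := by
    intro j
    have h1 := sq_le_eigenvalue hPL hl (R := η * Λ)
      (fun e => mul_le_mul_of_nonneg_left (hR e) hη0.le) j
    set y := (j : ℝ) / (q * (η * Λ)) with hy
    have h2 : (j : ℝ) * a = β * (2 * t * y) := by rw [ha, hy]; ring
    have h3 : 2 * t * y - t ^ 2 ≤ y ^ 2 := by nlinarith [sq_nonneg (y - t)]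
    rw [h2]
    calc β * δ / 2 + β * (2 * t * y) = β * (δ / 2 + 2 * t * y) := by ring
      _ ≤ β * (eigenvalue (Γ.scaledLen η) P L (j + 2 * q) - m) := by gcongr; linarith
  obtain ⟨-, htsum⟩ := summable_and_tsum_bose_le (by positivity) ha0 hx
  simp only [occupationDensity, Γ.sum_scaledLen, ← hΛ]
  rw [tsum_mul_left]
  have hgeo : (1 - Real.exp (-a))⁻¹ ≤ 1 + 1 / a := by
    have h1 : Real.exp (-a) ≤ 1 / (1 + a) := by
      rw [Real.exp_neg, ← one_div]
      exact one_div_le_one_div_of_le (by positivity) (by linarith [Real.add_one_le_exp a])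
    have h2 : a / (1 + a) ≤ 1 - Real.exp (-a) := by
      have : a / (1 + a) = 1 - 1 / (1 + a) := by field_simp; ring
      linarith
    calc (1 - Real.exp (-a))⁻¹ ≤ (a / (1 + a))⁻¹ := inv_anti₀ (by positivity) h2
      _ = 1 + 1 / a := by field_simp; ring
  have hbose : 1 / (Real.exp (β * δ / 2) - 1) ≤ 2 / (β * δ) := by
    calc 1 / (Real.exp (β * δ / 2) - 1) ≤ 1 / (β * δ / 2) :=
          one_div_le_one_div_of_le (by positivity) (by linarith [Real.add_one_le_exp (β * δ / 2)])
      _ = _ := by field_simp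
  have hpre : 1 / (η * Λ) * (1 + 1 / a) ≤ (1 + q * Λ / (2 * t)) / Λ := by
    have h1 : 1 / (η * Λ) * (1 + 1 / a) = (1 / η + q * Λ / (2 * t) * (1 / β)) / Λ := by
      rw [ha]; field_simp
    rw [h1]
    have h2 : 1 / η ≤ 1 := (div_le_one hη0).2 hη
    have h3 : 1 / β ≤ 1 := (div_le_one hβ0).2 hβ
    have h4 : q * Λ / (2 * t) * (1 / β) ≤ q * Λ / (2 * t) :=
      mul_le_of_le_one_right (by positivity) h3
    gcongr
  have hb0 : 0 ≤ 1 / (Real.exp (β * δ / 2) - 1) := (one_div_exp_sub_one_pos (by positivity)).le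
  calc 1 / (η * Λ) * ∑' j, 1 / (Real.exp (β *
        (eigenvalue (Γ.scaledLen η) P L (j + 2 * q) - m)) - 1)
      ≤ 1 / (η * Λ) * ((1 + 1 / a) * (2 / (β * δ))) := by
        refine mul_le_mul_of_nonneg_left (htsum.trans ?_) (by positivity)
        exact mul_le_mul hgeo hbose hb0 (by positivity)
    _ = (1 / (η * Λ) * (1 + 1 / a)) * (2 / (β * δ)) := by ring
    _ ≤ (1 + q * Λ / (2 * t)) / Λ * (2 / (β * δ)) := by gcongr
    _ = _ := by field_simp

/-- At low temperature the finitely many eigenstates below the tail carry half of the density, and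
the ground state has the largest share of it. -/
theorem exists_macroscopicallyOccupied (Γ : CompactMetricGraph V E) (hPL : IsBoundaryData P L)
    {c : ℝ} (hc : 0 < c) (hev : Module.End.HasEigenvalue (Matrix.toLin' L) (c : ℂ)) {ρ : ℝ}
    (hρ : 0 < ρ) :
    ∃ β₀ : ℝ, 0 < β₀ ∧ ∀ β, β₀ < β → ∀ μ : ℝ → ℝ,
      (∀ η : ℝ, 0 < η → IsChemicalPotential (Γ.scaledLen η) P L ρ β (μ η)) →
      MacroscopicallyOccupied Γ P L β μ 0 := by
  obtain ⟨K, hK, htail⟩ := exists_tsum_occupationDensity_le Γ hPL (δ := c ^ 2 / 2) (by positivity)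
  refine ⟨max 1 (2 * K / ρ), by positivity, fun β hβ μ hμ => ?_⟩
  have hβ1 : 1 < β := (le_max_left _ _).trans_lt hβ
  have hβ2 : 2 * K / ρ < β := (le_max_right _ _).trans_lt hβ
  have hβ0 : 0 < β := by linarith
  have hq0 : (0 : ℝ) < Fintype.card E := by exact_mod_cast Fintype.card_pos
  have hlong : ∀ᶠ η in atTop, ∀ e, 4 ≤ c * Γ.scaledLen η e := by
    rw [eventually_all]
    intro e
    have hce : 0 < c * Γ.len e := mul_pos hc (Γ.len_pos e)
    filter_upwards [eventually_ge_atTop (4 / (c * Γ.len e))] with η hη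
    rw [div_le_iff₀ hce] at hη
    calc 4 ≤ η * (c * Γ.len e) := hη
      _ = c * Γ.scaledLen η e := by unfold CompactMetricGraph.scaledLen; ring
  have hev' : ∀ᶠ η in atTop, ρ / (4 * Fintype.card E) ≤
      occupationDensity (Γ.scaledLen η) P L β (μ η) 0 := by
    filter_upwards [hlong, eventually_ge_atTop 1] with η h4 hη
    have hη0 : 0 < η := by linarith
    have hl := Γ.scaledLen_pos hη0
    obtain ⟨hm, hsum⟩ := hμ η hη0
    obtain ⟨p, hp⟩ := exists_isTrialFamily_of_hasEigenvalue hPL hl hc hev h4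
    have hmδ : μ η ≤ -(c ^ 2 / 2) := hm.le.trans (hp.eigenvalue_le hPL hl)
    have h1 := htail β η (μ η) hβ1.le hη hmδ
    have h2 := hsum.summable.sum_add_tsum_nat_add (2 * Fintype.card E)
    rw [hsum.tsum_eq] at h2
    have h3 := Finset.sum_le_card_nsmul (Finset.range (2 * Fintype.card E)) _ _
      fun n _ => occupationDensity_anti hPL hl hβ0 hm n
    rw [Finset.card_range, nsmul_eq_mul] at h3
    push_cast at h3
    have h5 : K / β ≤ ρ / 2 := by
      rw [div_lt_iff₀ hρ] at hβ2
      rw [div_le_div_iff₀ hβ0 (by norm_num)]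
      linarith
    rw [div_le_iff₀ (by positivity)]
    linarith
  have h6 : (0 : EReal) < ((ρ / (4 * Fintype.card E) : ℝ) : EReal) :=
    EReal.coe_pos.2 (by positivity)
  refine h6.trans_le (le_limsup_of_frequently_le ?_ (by isBoundedDefault))
  refine Eventually.frequently (hev'.mono fun η hη => ?_)
  exact_mod_cast hη

end ThermodynamicLimit

end QuantumGraph

theorem mainTheorem1 {V E : Type*} [Fintype V] [Fintype E] [DecidableEq E] [Nonempty E]
    (Γ : QuantumGraph.CompactMetricGraph V E) (P L : Matrix (E ⊕ E) (E ⊕ E) ℂ)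
    (hPL : QuantumGraph.IsBoundaryData P L) (kB : ℝ) (hkB : 0 < kB) :
    (∀ ρ T η : ℝ, 0 < ρ → 0 < T → 0 < η →
      ∃! m : ℝ, QuantumGraph.IsChemicalPotential (Γ.scaledLen η) P L ρ (1 / (kB * T)) m) ∧
    ((-L).PosSemidef →
      ∀ ρ T : ℝ, 0 < ρ → 0 < T → ∀ μ : ℝ → ℝ,
        (∀ η : ℝ, 0 < η →
          QuantumGraph.IsChemicalPotential (Γ.scaledLen η) P L ρ (1 / (kB * T)) (μ η)) →
        ¬ ∃ n : ℕ, QuantumGraph.MacroscopicallyOccupied Γ P L (1 / (kB * T)) μ n) ∧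
    ((∃ c : ℝ, 0 < c ∧ Module.End.HasEigenvalue (Matrix.toLin' L) (c : ℂ)) →
      ∀ ρ : ℝ, 0 < ρ → ∃ Tc : ℝ, 0 < Tc ∧ ∀ T : ℝ, 0 < T → T < Tc → ∀ μ : ℝ → ℝ,
        (∀ η : ℝ, 0 < η →
          QuantumGraph.IsChemicalPotential (Γ.scaledLen η) P L ρ (1 / (kB * T)) (μ η)) →
        QuantumGraph.MacroscopicallyOccupied Γ P L (1 / (kB * T)) μ 0) := by
  have hβ : ∀ T : ℝ, 0 < T → 0 < 1 / (kB * T) := fun T hT => by positivity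
  refine ⟨fun ρ T η hρ hT hη => ?_, fun hL ρ T hρ hT μ hμ => ?_, ?_⟩
  · exact QuantumGraph.existsUnique_isChemicalPotential hPL (Γ.scaledLen_pos hη) (hβ T hT) hρ
  · rintro ⟨n, hn⟩
    exact QuantumGraph.not_macroscopicallyOccupied Γ hPL hL (hβ T hT) hμ n hn
  · rintro ⟨c, hc, hev⟩ ρ hρ
    obtain ⟨β₀, hβ₀, h⟩ := QuantumGraph.exists_macroscopicallyOccupied Γ hPL hc hev hρ
    refine ⟨1 / (kB * β₀), by positivity, fun T hT hTc μ hμ => h _ ?_ μ hμ⟩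
    rw [lt_div_iff₀ (by positivity)] at hTc ⊢
    linarith
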